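/- Network class. Let $L\ge 0$, $d_0,\dots,d_L\le D$ be integers, and let $\sigma_l:\mathbb R^{d_l}\to\mathbb R^{d_l}$ be $\rho_l$-Lipschitz (Euclidean norms) with $\sigma_l(0)=0$, $1\le l\le L$. Let $M_l\in\mathbb R^{d_l\times d_{l-1}}$ be fixed reference matrices, $s_l>0$, $b_l\ge 0$, and let $\Theta$ be the set of weights $\boldsymbol\theta=(A_1,\dots,A_L)$, $A_l\in\mathbb R^{d_l\times d_{l-1}}$, with spectral norm $\|A_l\|_2\le s_l$ and $\|A_l^{\top}-M_l^{\top}\|_{2,1}\le b_l$, where $\|\cdot\|_{2,1}$ is the sum of the Euclidean norms of the columns. Put $\mathrm{net}(x;\boldsymbol\theta)=\sigma_L(A_L\sigma_{L-1}(\cdots\sigma_1(A_1x)))$, $K=d_L$, $f_{\boldsymbol\theta}=\mathrm{softmax}(\mathrm{net}(\cdot;\boldsymbol\theta)):\mathbb R^{d_0}\to\mathbb R^K$, $\mathcal F=\{f_{\boldsymbol\theta}:\boldsymbol\theta\in\Theta\}$ and $$R_{\rm NET}=\log(2D^2)\Big(\prod_{l=1}^L s_l^2\rho_l^2\Big)\Big(\sum_{l=1}^L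 (b_l/s_l)^{2/3}\Big)^3 .$$ Let $\mathcal X\subseteq\mathbb R^{d_0}$, let $x_1,\dots,x_N\in\mathcal X$ be given data points, and let $f^\natural$ map every point of $\mathcal X$ into the probability simplex of $\mathbb R^K$. Put $P^\natural_{ij}=\langle f^\natural(x_i),f^\natural(x_j)\rangle$. Assume that for some $0<\nu<1$ there is $\widetilde f\in\mathcal F$ with $\|\widetilde f(x)-f^\natural(x)\|\le\nu$ for all $x\in\mathcal X$, and that for some $0<\alpha<1$ one has $\alpha<f(x)^\top f(y)<1-\alpha$ for all $x,y\in\mathcal X$ and $f\in\mathcal F$. Let $M\ge 1$ and let $(i_1,j_1,y_1),\dots,(i_M,j_M,y_M)$ be independent, with $(i_m,j_m)$ uniform on $[N]\times[N]$ and $y_m\mid(i_m,j_m)\sim\mathrm{Bernoulli}(P^\natural_{i_m,j_m})$. Let $S_X=[x_{i_1},x_{j_1},\dots,x_{i_M},x_{j_M}]$. Then for every $\delta\in(0,1)$, with probability at least $1-\delta$, every minimizer $\boldsymbol\theta^\star$ over $\Theta$ of the logistic loss $$\frac1M\sum_{m=1}^M\Big(y_m\log\frac1{f_{\boldsymbol\theta}(x_{i_m})^\top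 f_{\boldsymbol\theta}(x_{j_m})}+(1-y_m)\log\frac1{1-f_{\boldsymbol\theta}(x_{i_m})^\top f_{\boldsymbol\theta}(x_{j_m})}\Big)$$ satisfies, with $P^\star_{ij}=\langle f_{\boldsymbol\theta^\star}(x_i),f_{\boldsymbol\theta^\star}(x_j)\rangle$, $$\frac1{N^2}\|P^\star-P^\natural\|_F^2\le\frac{64\log(1/\alpha)}{M}+\frac{96\sqrt2\,\log M}{\alpha M\log 2}\|S_X\|_F\sqrt{R_{\rm NET}}+64\log(1/\alpha)\sqrt{\frac{2\log(4/\delta)}{M}}+\frac{16\nu}{\alpha}.$$ -/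

import Mathlib

open MeasureTheory ProbabilityTheory
open scoped NNReal

noncomputable section

namespace PairwiseClustering

/-- `ℝᵈ` with its Euclidean norm. -/
abbrev Vec (d : ℕ) : Type := EuclideanSpace ℝ (Fin d)

/-- Frobenius norm of a real matrix. -/
def frobNorm {m n : Type*} [Fintype m] [Fintype n] (A : Matrix m n ℝ) : ℝ :=
  √(∑ i, ∑ j, A i j ^ 2)

/-- Spectral norm: the operator norm with respect to the Euclidean norms. -/
def matSpectralNorm {m n : ℕ} (A : Matrix (Fin m) (Fin n) ℝ) : ℝ :=
  ‖LinearMap.toContinuousLinearMap (Matrix.toEuclideanLin A)‖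

/-- The `(2,1)` norm: the sum of the Euclidean norms of the columns. -/
def twoOneNorm {m n : ℕ} (A : Matrix (Fin m) (Fin n) ℝ) : ℝ :=
  ∑ j, √(∑ i, A i j ^ 2)

/-- Softmax, `[softmax z]_k = exp z_k / ∑_l exp z_l`. -/
def softmax {K : ℕ} (z : Vec K) : Vec K :=
  WithLp.toLp 2 fun k => Real.exp (z k) / ∑ l, Real.exp (z l)

/-- A feed-forward network architecture of depth `L` together with the norm bounds that its
weights have to satisfy. Layer `l` multiplies by a matrix of size `width l.succ × width l.castSucc`
and then applies a fixed Lipschitz nonlinearity that vanishes at the origin. -/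
structure NetSpec (L : ℕ) where
  /-- Layer widths; the input dimension is `width 0`, the output dimension `width (Fin.last L)`. -/
  width : Fin (L + 1) → ℕ
  /-- A bound on all the widths. -/
  maxWidth : ℕ
  width_le : ∀ l, width l ≤ maxWidth
  /-- The nonlinearities. -/
  act : (l : Fin L) → Vec (width l.succ) → Vec (width l.succ)
  /-- Their Lipschitz constants. -/
  lip : Fin L → ℝ≥0
  act_lipschitz : ∀ l, LipschitzWith (lip l) (act l)
  act_zero : ∀ l, act l 0 = 0
  /-- The reference matrices. -/
  ref : (l : Fin L) → Matrix (Fin (width l.succ)) (Fin (width l.castSucc)) ℝ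
  /-- The bounds on the spectral norms of the weights. -/
  s : Fin L → ℝ
  s_pos : ∀ l, 0 < s l
  /-- The bounds on the `(2,1)` distances of the transposed weights to the transposed
  reference matrices. -/
  b : Fin L → ℝ
  b_nonneg : ∀ l, 0 ≤ b l

namespace NetSpec

variable {L : ℕ} (net : NetSpec L)

/-- Input dimension. -/
abbrev inDim : ℕ := net.width 0

/-- Output dimension, i.e. the number of clusters. -/
abbrev outDim : ℕ := net.width (Fin.last L)

/-- A choice of all weight matrices. -/
abbrev Weights : Type :=
  (l : Fin L) → Matrix (Fin (net.width l.succ)) (Fin (net.width l.castSucc)) ℝ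

/-- The admissible weights. -/
def params : Set net.Weights :=
  {A | ∀ l, matSpectralNorm (A l) ≤ net.s l ∧
    twoOneNorm ((A l).transpose - (net.ref l).transpose) ≤ net.b l}

/-- The output of the first `l` layers on the input `u`. -/
def layer (A : net.Weights) (u : Vec net.inDim) (l : Fin (L + 1)) : Vec (net.width l) :=
  Fin.induction (motive := fun l => Vec (net.width l)) u
    (fun l h => net.act l (Matrix.toEuclideanLin (A l) h)) l

/-- The network map `net(u; A) = σ_L (A_L σ_{L-1} (⋯ σ_1 (A_1 u)))`. -/
def eval (A : net.Weights) (u : Vec net.inDim) : Vec net.outDim :=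
  net.layer A u (Fin.last L)

/-- The network with the softmax output layer, `f_A = softmax (net(·; A))`. -/
def fn (A : net.Weights) (u : Vec net.inDim) : Vec net.outDim :=
  softmax (net.eval A u)

/-- The function class `{f_A | A admissible}`. -/
def functionClass : Set (Vec net.inDim → Vec net.outDim) :=
  net.fn '' net.params

/-- The complexity measure
`log (2 D²) (∏_l s_l² ρ_l²) (∑_l (b_l / s_l)^(2/3))³` of the network. -/
def complexity : ℝ :=
  Real.log (2 * (net.maxWidth : ℝ) ^ 2) * (∏ l, net.s l ^ 2 * (net.lip l : ℝ) ^ 2) *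
    (∑ l, (net.b l / net.s l) ^ (2 / 3 : ℝ)) ^ 3

end NetSpec

/-- The matrix of inner products `⟨f x_a, f x_b⟩`. -/
def gram {d K N : ℕ} (f : Vec d → Vec K) (x : Fin N → Vec d) : Matrix (Fin N) (Fin N) ℝ :=
  Matrix.of fun a b => inner ℝ (f (x a)) (f (x b))

/-- The logistic pairwise loss of `f` on the annotated pairs `(i_m, j_m, y_m)`. -/
def logisticLoss {d K N M : ℕ} (x : Fin N → Vec d) (i j : Fin M → Fin N) (y : Fin M → Fin 2)
    (f : Vec d → Vec K) : ℝ :=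
  1 / (M : ℝ) * ∑ m,
    (((y m : ℕ) : ℝ) * Real.log (1 / inner ℝ (f (x (i m))) (f (x (j m)))) +
      (1 - ((y m : ℕ) : ℝ)) * Real.log (1 / (1 - inner ℝ (f (x (i m))) (f (x (j m))))))

/-- The matrix `[x_{i_1}, x_{j_1}, …, x_{i_M}, x_{j_M}]` of all sampled data points. -/
def sampleMatrix {d N M : ℕ} (x : Fin N → Vec d) (i j : Fin M → Fin N) :
    Matrix (Fin d) (Fin M × Fin 2) ℝ :=
  Matrix.of fun r c => x (if c.2 = 0 then i c.1 else j c.1) r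

/-- The random annotations `(i_m, j_m, y_m)` are independent over `m`, each pair `(i_m, j_m)` is
uniform on `[N] × [N]`, and given `(i_m, j_m) = (a, b)` the label `y_m` is Bernoulli with
parameter `P a b`. -/
structure IsAnnotationSample {Ω : Type*} [MeasurableSpace Ω] (μ : Measure Ω) {N M : ℕ}
    (P : Matrix (Fin N) (Fin N) ℝ) (i j : Fin M → Ω → Fin N) (y : Fin M → Ω → Fin 2) : Prop where
  measurable_fst : ∀ m, Measurable (i m)
  measurable_snd : ∀ m, Measurable (j m)
  measurable_label : ∀ m, Measurable (y m)
  indep : iIndepFun (fun m ω => (i m ω, j m ω, y m ω)) μ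
  uniform : ∀ m a b, μ.real {ω | i m ω = a ∧ j m ω = b} = 1 / (N : ℝ) ^ 2
  bernoulli : ∀ m a b, (μ[|{ω | i m ω = a ∧ j m ω = b}]).real {ω | y m ω = 1} = P a b

/-- The error bound `ε(M, δ)²`, where `SF` stands for the Frobenius norm of the matrix of sampled
data points and `R` for the complexity of the network. -/
def errorSq (α ν δ : ℝ) (M : ℕ) (SF R : ℝ) : ℝ :=
  64 * Real.log (1 / α) / M +
    96 * √2 * Real.log M / (α * M * Real.log 2) * SF * √R +
    64 * Real.log (1 / α) * √(2 * Real.log (4 / δ) / M) +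
    16 * ν / α

end PairwiseClustering

end

namespace PairwiseClustering

/-! The expected logistic loss of weights `θ` is the average of `crossEntropy (P a b) (Q a b)`, with
`Q` the Gram matrix of `net.fn θ`, so its excess over the loss of the truth is an averaged Bernoulli
Kullback–Leibler divergence. By `sq_sub_le_crossEntropy_sub` this excess dominates the squared
Frobenius error. The admissible approximant `A₀` has excess at most `8 * ν / α`, since the
divergence is below the chi-square distance (`excess_le_of_approx`). An empirical minimizer has
empirical loss at most that of `A₀`, so what remains is a deviation bound holding simultaneously for
all `θ`.

That bound is `sum_weights_deviation_le`: symmetrization controls the mean deviation by twice the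
Rademacher complexity, and a single use of McDiarmid's inequality replaces means by empirical
quantities. One annotation takes finitely many values, so probabilities and expectations are finite
weighted sums and suprema over weights raise no measurability question; `one_sub_le_measureReal`
returns to `μ`.

The empirical Rademacher complexity is bounded by dyadic chaining (`empRad_le_of_cover`) from covers
with log-cardinality `H ^ 2 / ε ^ 2`. Such covers come from Maurey's method for one matrix
(`exists_matrix_cover`), composed layer by layer with optimized radii (`exists_eval_cover`), then
transported through the Lipschitz softmax, inner product and logarithm (`sum_sq_netLoss_sub_le`). -/

/-- Expectation of `φ` under `n` independent draws with weights `p`. -/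
noncomputable def prodExp {Z : Type*} [Fintype Z] (p : Z → ℝ) {n : ℕ} (φ : (Fin n → Z) → ℝ) : ℝ :=
  ∑ z, (∏ m, p (z m)) * φ z

/-! ### Finite product expectations and McDiarmid's inequality. -/

section Basic

variable {Z : Type*} [Fintype Z] {p : Z → ℝ} {n : ℕ}

theorem prodExp_succ (φ : (Fin (n + 1) → Z) → ℝ) :
    prodExp p φ = ∑ a, p a * prodExp p (fun z => φ (Fin.cons a z)) := by
  unfold prodExp
  rw [← (Fin.consEquiv (fun _ : Fin (n + 1) => Z)).sum_comp, Fintype.sum_prod_type]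
  refine Finset.sum_congr rfl fun a _ => ?_
  rw [Finset.mul_sum]
  refine Finset.sum_congr rfl fun z _ => ?_
  simp [Fin.consEquiv, Fin.prod_univ_succ, mul_assoc]

theorem prodExp_mono (hp : ∀ a, 0 ≤ p a) {φ ψ : (Fin n → Z) → ℝ} (h : ∀ z, φ z ≤ ψ z) :
    prodExp p φ ≤ prodExp p ψ :=
  Finset.sum_le_sum fun z _ =>
    mul_le_mul_of_nonneg_left (h z) (Finset.prod_nonneg fun m _ => hp (z m))

theorem prodExp_add (φ ψ : (Fin n → Z) → ℝ) :
    prodExp p (fun z => φ z + ψ z) = prodExp p φ + prodExp p ψ := by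
  simp [prodExp, mul_add, Finset.sum_add_distrib]

theorem prodExp_sub (φ ψ : (Fin n → Z) → ℝ) :
    prodExp p (fun z => φ z - ψ z) = prodExp p φ - prodExp p ψ := by
  simp [prodExp, mul_sub, Finset.sum_sub_distrib]

theorem prodExp_const_mul (c : ℝ) (φ : (Fin n → Z) → ℝ) :
    prodExp p (fun z => c * φ z) = c * prodExp p φ := by
  simp only [prodExp, Finset.mul_sum]
  exact Finset.sum_congr rfl fun z _ => by ring

theorem prodExp_sum {ι : Type*} (s : Finset ι) (φ : ι → (Fin n → Z) → ℝ) :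
    prodExp p (fun z => ∑ k ∈ s, φ k z) = ∑ k ∈ s, prodExp p (φ k) := by
  simp only [prodExp, Finset.mul_sum]
  exact Finset.sum_comm

theorem prodExp_prod (f : Fin n → Z → ℝ) :
    prodExp p (fun z => ∏ m, f m (z m)) = ∏ m, ∑ a, p a * f m a := by
  classical
  rw [Finset.prod_univ_sum]
  simp [prodExp, Finset.prod_mul_distrib]

theorem sum_prod_weights (hp1 : ∑ a, p a = 1) : ∑ z : Fin n → Z, ∏ m, p (z m) = 1 := by
  have := prodExp_prod (p := p) (n := n) (fun _ _ => 1)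
  simpa [prodExp, hp1] using this

theorem prodExp_const (hp1 : ∑ a, p a = 1) (c : ℝ) :
    prodExp p (fun _ : Fin n → Z => c) = c := by
  rw [prodExp, ← Finset.sum_mul, sum_prod_weights hp1, one_mul]

theorem prodExp_eval (hp1 : ∑ a, p a = 1) (m : Fin n) (g : Z → ℝ) :
    prodExp p (fun z => g (z m)) = ∑ a, p a * g a := by
  classical
  have := prodExp_prod (p := p) (fun k a => if k = m then g a else 1)
  have h1 : ∀ z : Fin n → Z, (∏ k, if k = m then g (z k) else 1) = g (z m) := fun z => by
    rw [Finset.prod_ite_eq' Finset.univ m]; simp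
  simp only [h1] at this
  rw [this, Finset.prod_eq_single m]
  · simp
  · intro k _ hk; simp [hk, hp1]
  · simp

theorem exp_prodExp_le (hp : ∀ a, 0 ≤ p a) (hp1 : ∑ a, p a = 1) (φ : (Fin n → Z) → ℝ) :
    Real.exp (prodExp p φ) ≤ prodExp p (fun z => Real.exp (φ z)) := by
  have := convexOn_exp.map_sum_le (t := Finset.univ) (w := fun z : Fin n → Z => ∏ m, p (z m))
    (p := φ) (fun z _ => Finset.prod_nonneg fun m _ => hp (z m)) (sum_prod_weights hp1)
    (fun _ _ => Set.mem_univ _)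
  simpa [prodExp] using this

/-- Weak form of Hoeffding's lemma. -/
theorem sum_exp_sub_mean_le (hp : ∀ a, 0 ≤ p a) (hp1 : ∑ a, p a = 1) {ψ : Z → ℝ} {c : ℝ}
    (hψ : ∀ a b, |ψ a - ψ b| ≤ c) :
    ∑ a, p a * Real.exp (ψ a - ∑ b, p b * ψ b) ≤ Real.exp (c ^ 2 / 2) := by
  -- Jensen replaces the mean by an independent copy `b`. Exchanging `a` and `b` then turns the
  -- exponential into `cosh`, bounded by a Gaussian; this yields `c ^ 2 / 2` instead of Hoeffding's
  -- sharp `c ^ 2 / 8`.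
  have hJ : Real.exp (-∑ b, p b * ψ b) ≤ ∑ b, p b * Real.exp (-ψ b) := by
    have := convexOn_exp.map_sum_le (t := Finset.univ) (w := p)
      (p := fun b => -ψ b) (fun z _ => hp z) hp1 (fun _ _ => Set.mem_univ _)
    simpa using this
  have h1 : ∑ a, p a * Real.exp (ψ a - ∑ b, p b * ψ b)
      ≤ ∑ a, ∑ b, p a * p b * Real.exp (ψ a - ψ b) := by
    refine Finset.sum_le_sum fun a _ => ?_
    rw [sub_eq_add_neg, Real.exp_add]
    calc p a * (Real.exp (ψ a) * Real.exp (-∑ b, p b * ψ b))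
        ≤ p a * (Real.exp (ψ a) * ∑ b, p b * Real.exp (-ψ b)) := by
          have := hp a; gcongr
      _ = _ := by
          rw [Finset.mul_sum, Finset.mul_sum]
          refine Finset.sum_congr rfl fun b _ => ?_
          rw [sub_eq_add_neg, Real.exp_add]; ring
  have h2 : ∑ a, ∑ b, p a * p b * Real.exp (ψ a - ψ b)
      = ∑ a, ∑ b, p a * p b * Real.cosh (ψ a - ψ b) := by
    have hs : ∑ a, ∑ b, p a * p b * Real.exp (ψ a - ψ b)
        = ∑ a, ∑ b, p a * p b * Real.exp (-(ψ a - ψ b)) := by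
      rw [Finset.sum_comm]
      refine Finset.sum_congr rfl fun a _ => Finset.sum_congr rfl fun b _ => ?_
      rw [neg_sub, mul_comm (p b)]
    have : ∑ a, ∑ b, p a * p b * Real.cosh (ψ a - ψ b)
        = (∑ a, ∑ b, p a * p b * Real.exp (ψ a - ψ b)
          + ∑ a, ∑ b, p a * p b * Real.exp (-(ψ a - ψ b))) / 2 := by
      simp only [← Finset.sum_add_distrib, Finset.sum_div, Real.cosh_eq]
      exact Finset.sum_congr rfl fun a _ => Finset.sum_congr rfl fun b _ => by ring
    rw [this, ← hs]; ring
  refine h1.trans (h2.trans_le ?_)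
  calc ∑ a, ∑ b, p a * p b * Real.cosh (ψ a - ψ b)
      ≤ ∑ a, ∑ b, p a * p b * Real.exp (c ^ 2 / 2) := by
        refine Finset.sum_le_sum fun a _ => Finset.sum_le_sum fun b _ => ?_
        refine mul_le_mul_of_nonneg_left ?_ (mul_nonneg (hp a) (hp b))
        refine (Real.cosh_le_exp_half_sq _).trans (Real.exp_le_exp.2 ?_)
        have := sq_le_sq' (by linarith [abs_nonneg (ψ a - ψ b), hψ a b, neg_abs_le (ψ a - ψ b)])
          (hψ a b)
        rw [sq_abs] at this
        linarith
    _ = Real.exp (c ^ 2 / 2) := by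
        simp only [← Finset.sum_mul, ← Finset.mul_sum, hp1, mul_one, one_mul]

/-- McDiarmid's exponential moment bound for functions with bounded differences. -/
theorem prodExp_exp_sub_mean_le (hp : ∀ a, 0 ≤ p a) (hp1 : ∑ a, p a = 1) {c : ℝ} :
    ∀ {n : ℕ} (φ : (Fin n → Z) → ℝ), (∀ z m a, |φ (Function.update z m a) - φ z| ≤ c) →
      prodExp p (fun z => Real.exp (φ z - prodExp p φ)) ≤ Real.exp (n * (c ^ 2 / 2)) := by
  intro n
  induction n with
  | zero =>
    intro φ _
    have h : ∀ z : Fin 0 → Z, φ z = φ Fin.elim0 := fun z => by rw [Subsingleton.elim z Fin.elim0]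
    have hz : φ = fun _ => φ Fin.elim0 := funext h
    rw [hz]
    simp [prodExp_const hp1]
  | succ n ih =>
    intro φ hφ
    -- `ψ` is the conditional mean given the first draw. Its oscillation is at most `c`, so the
    -- one-variable bound handles it, and the induction hypothesis handles the fluctuation around
    -- it.
    set ψ : Z → ℝ := fun a => prodExp p (fun z : Fin n → Z => φ (Fin.cons a z)) with hψdef
    have hmean : prodExp p φ = ∑ a, p a * ψ a := prodExp_succ φ
    have hinner : ∀ a, prodExp p (fun z : Fin n → Z => Real.exp (φ (Fin.cons a z) - ψ a))
        ≤ Real.exp (n * (c ^ 2 / 2)) := fun a => by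
      refine ih (fun z => φ (Fin.cons a z)) fun z m b => ?_
      have := hφ (Fin.cons a z) m.succ b
      rwa [← Fin.cons_update] at this
    have hψ : ∀ a b, |ψ a - ψ b| ≤ c := by
      have key : ∀ a b, ψ a - ψ b ≤ c := fun a b => by
        rw [hψdef]
        simp only
        rw [← prodExp_sub]
        calc _ ≤ prodExp p (fun _ : Fin n → Z => c) := by
              refine prodExp_mono hp fun z => ?_
              have := hφ (Fin.cons b z) 0 a
              rw [Fin.update_cons_zero] at this
              exact (le_abs_self _).trans this
          _ = c := prodExp_const hp1 c
      exact fun a b => abs_sub_le_iff.2 ⟨key a b, key b a⟩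
    rw [hmean, prodExp_succ]
    calc ∑ a, p a * prodExp p (fun z : Fin n → Z =>
            Real.exp (φ (Fin.cons a z) - ∑ b, p b * ψ b))
        = ∑ a, p a * Real.exp (ψ a - ∑ b, p b * ψ b) *
            prodExp p (fun z : Fin n → Z => Real.exp (φ (Fin.cons a z) - ψ a)) := by
          refine Finset.sum_congr rfl fun a _ => ?_
          rw [mul_assoc, ← prodExp_const_mul (Real.exp (ψ a - ∑ b, p b * ψ b))]
          refine congrArg (p a * ·) (congrArg (prodExp p) (funext fun z => ?_))
          rw [← Real.exp_add]
          congr 1; ring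
      _ ≤ ∑ a, p a * Real.exp (ψ a - ∑ b, p b * ψ b) * Real.exp (n * (c ^ 2 / 2)) := by
          refine Finset.sum_le_sum fun a _ => ?_
          exact mul_le_mul_of_nonneg_left (hinner a) (mul_nonneg (hp a) (Real.exp_pos _).le)
      _ ≤ Real.exp (c ^ 2 / 2) * Real.exp (n * (c ^ 2 / 2)) := by
          rw [← Finset.sum_mul]
          exact mul_le_mul_of_nonneg_right (sum_exp_sub_mean_le hp hp1 hψ) (Real.exp_pos _).le
      _ = _ := by rw [← Real.exp_add]; push_cast; congr 1; ring

open Classical in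
/-- McDiarmid's inequality for a function with nonpositive mean. -/
theorem sum_weights_tail_le (hp : ∀ a, 0 ≤ p a) (hp1 : ∑ a, p a = 1) {c : ℝ} (hc : 0 < c)
    (hn : 0 < n) (φ : (Fin n → Z) → ℝ) (hφ : ∀ z m a, |φ (Function.update z m a) - φ z| ≤ c)
    (hmean : prodExp p φ ≤ 0) {t : ℝ} (ht : 0 ≤ t) :
    ∑ z with t < φ z, ∏ m, p (z m) ≤ Real.exp (-(t ^ 2 / (2 * (n * c ^ 2)))) := by
  have hn' : (0 : ℝ) < n := by exact_mod_cast hn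
  have hv : 0 < n * c ^ 2 := by positivity
  -- Chernoff's method with the `r` minimizing `-r * t + n * r ^ 2 * c ^ 2 / 2`.
  set r := t / (n * c ^ 2) with hr
  have hr0 : 0 ≤ r := by positivity
  have hmgf := prodExp_exp_sub_mean_le hp hp1 (c := r * c) (fun z => r * φ z) (fun z m a => by
    rw [← mul_sub, abs_mul, abs_of_nonneg hr0]
    exact mul_le_mul_of_nonneg_left (hφ z m a) hr0)
  rw [prodExp_const_mul] at hmgf
  have h1 : ∑ z with t < φ z, ∏ m, p (z m)
      ≤ prodExp p (fun z => Real.exp (-(r * t)) * Real.exp (r * φ z - r * prodExp p φ)) := by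
    unfold prodExp
    rw [Finset.sum_filter]
    refine Finset.sum_le_sum fun z _ => ?_
    have hw : 0 ≤ ∏ m, p (z m) := Finset.prod_nonneg fun m _ => hp (z m)
    split_ifs with h
    · refine le_mul_of_one_le_right hw ?_
      simp only [← Real.exp_add]
      refine Real.one_le_exp ?_
      have h2 : r * t ≤ r * φ z := mul_le_mul_of_nonneg_left h.le hr0
      have h3 : r * prodExp p φ ≤ 0 := mul_nonpos_of_nonneg_of_nonpos hr0 hmean
      unfold prodExp at h3
      linarith
    · positivity
  refine h1.trans ?_
  rw [prodExp_const_mul]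
  refine (mul_le_mul_of_nonneg_left hmgf (Real.exp_pos _).le).trans (le_of_eq ?_)
  rw [← Real.exp_add]
  congr 1
  rw [hr]
  field_simp
  ring

end Basic

/-! ### Random signs: Massart's bound and chaining. -/

section Rademacher

/-- The value `±1` of a sign. -/
def sgn (s : Bool) : ℝ := if s then 1 else -1

/-- Expectation over `n` independent uniform signs. -/
noncomputable abbrev signExp {n : ℕ} (φ : (Fin n → Bool) → ℝ) : ℝ := prodExp (fun _ => 1 / 2) φ

theorem half_nonneg (_ : Bool) : (0 : ℝ) ≤ 1 / 2 := by norm_num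

theorem sum_half : ∑ _s : Bool, (1 / 2 : ℝ) = 1 := by simp

theorem sgn_not (s : Bool) : sgn (!s) = -sgn s := by cases s <;> simp [sgn]

theorem abs_sgn (s : Bool) : |sgn s| = 1 := by cases s <;> simp [sgn]

variable {n : ℕ}

theorem signExp_not (φ : (Fin n → Bool) → ℝ) :
    signExp (fun e => φ (fun m => !(e m))) = signExp φ := by
  unfold signExp prodExp
  have hinv : Function.Involutive (fun (e : Fin n → Bool) (m : Fin n) => !(e m)) := fun e => by
    ext m; simp
  exact Equiv.sum_comp hinv.toPerm fun e => (∏ _m : Fin n, (1 / 2 : ℝ)) * φ e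

theorem signExp_sum_eq_zero (w : Fin n → ℝ) :
    signExp (fun e => ∑ m, sgn (e m) * w m) = 0 := by
  have h := signExp_not (fun e : Fin n → Bool => ∑ m, sgn (e m) * w m)
  simp only [sgn_not, neg_mul, Finset.sum_neg_distrib] at h
  have h2 := prodExp_const_mul (p := fun _ : Bool => (1 / 2 : ℝ)) (-1)
    (fun e : Fin n → Bool => ∑ m, sgn (e m) * w m)
  simp only [neg_mul, one_mul] at h2
  unfold signExp at h ⊢
  linarith

/-- The exponential moment factors over the independent signs, each factor being `cosh (w m) ≤ exp
(w m ^ 2 / 2)`. -/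
theorem signExp_exp_le (w : Fin n → ℝ) :
    signExp (fun e => Real.exp (∑ m, sgn (e m) * w m)) ≤ Real.exp ((∑ m, w m ^ 2) / 2) := by
  simp only [Real.exp_sum]
  rw [signExp, prodExp_prod (fun m (s : Bool) => Real.exp (sgn s * w m)), Finset.sum_div,
    Real.exp_sum]
  refine Finset.prod_le_prod (fun m _ => Finset.sum_nonneg fun s _ => by positivity) fun m _ => ?_
  have : ∑ a : Bool, (1 / 2 : ℝ) * Real.exp (sgn a * w m) = Real.cosh (w m) := by
    rw [Real.cosh_eq]; simp [sgn]; ring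
  rw [this]
  exact Real.cosh_le_exp_half_sq _

/-- The optimal choice is `r = √A / √B`. If `A` or `B` vanishes there is no minimizer, and `r` tends
to `0` or to infinity instead. -/
theorem le_two_sqrt_of_forall {x A B : ℝ} (hA : 0 ≤ A) (hB : 0 ≤ B)
    (h : ∀ r : ℝ, 0 < r → x ≤ A / r + r * B) : x ≤ 2 * √(A * B) := by
  rcases hA.eq_or_lt with rfl | hA'
  · simp only [zero_div, zero_add, zero_mul, Real.sqrt_zero, mul_zero] at h ⊢
    refine le_of_forall_pos_le_add fun e he => ?_
    have := h (e / (B + 1)) (by positivity)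
    have h2 : e / (B + 1) * B ≤ e := by
      rw [div_mul_eq_mul_div, div_le_iff₀ (by positivity)]; nlinarith
    linarith
  · rcases hB.eq_or_lt with rfl | hB'
    · simp only [mul_zero, add_zero, Real.sqrt_zero] at h ⊢
      refine le_of_forall_pos_le_add fun e he => ?_
      have := h (A / e) (by positivity)
      rw [div_div_cancel₀ hA'.ne'] at this
      linarith
    · have h1 := h (√A / √B) (by positivity)
      have sA := Real.mul_self_sqrt hA
      have sB := Real.mul_self_sqrt hB
      have e1 : A / (√A / √B) = √A * √B := by
        have : 0 < √A := by positivity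
        have : 0 < √B := by positivity
        field_simp; nlinarith
      have e2 : √A / √B * B = √A * √B := by
        have : 0 < √B := by positivity
        field_simp; nlinarith
      rw [Real.sqrt_mul hA]; linarith

/-- Massart's finite class bound. -/
theorem signExp_le_of_finite {ι : Type*} (T : Finset ι) (w : ι → Fin n → ℝ) {r A : ℝ}
    (hw : ∀ k ∈ T, ∑ m, w k m ^ 2 ≤ r ^ 2) (hr : 0 ≤ r) (hA : 0 ≤ A)
    (hT : (T.card : ℝ) ≤ Real.exp A) (Φ : (Fin n → Bool) → ℝ)
    (hΦ : ∀ e, ∃ k ∈ T, Φ e ≤ ∑ m, sgn (e m) * w k m) :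
    signExp Φ ≤ r * √(2 * A) := by
  have hcl : 2 * √(A * (r ^ 2 / 2)) = r * √(2 * A) := by
    have : A * (r ^ 2 / 2) = (r / 2) ^ 2 * (2 * A) := by ring
    rw [this, Real.sqrt_mul (by positivity), Real.sqrt_sq (by positivity)]; ring
  rw [← hcl]
  refine le_two_sqrt_of_forall hA (by positivity) fun c hc => ?_
  have h1 : Real.exp (c * signExp Φ) ≤ Real.exp (A + c ^ 2 * (r ^ 2 / 2)) := by
    rw [signExp, ← prodExp_const_mul]
    refine (exp_prodExp_le half_nonneg sum_half _).trans ?_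
    calc prodExp (fun _ : Bool => (1 / 2 : ℝ)) (fun e => Real.exp (c * Φ e))
        ≤ prodExp (fun _ : Bool => (1 / 2 : ℝ))
            (fun e => ∑ k ∈ T, Real.exp (∑ m, sgn (e m) * (c * w k m))) := by
          refine prodExp_mono half_nonneg fun e => ?_
          obtain ⟨k, hk, hle⟩ := hΦ e
          refine le_trans (Real.exp_le_exp.2 ?_) (Finset.single_le_sum
            (f := fun k => Real.exp (∑ m, sgn (e m) * (c * w k m)))
            (fun k _ => (Real.exp_pos _).le) hk)
          calc c * Φ e ≤ c * ∑ m, sgn (e m) * w k m := mul_le_mul_of_nonneg_left hle hc.le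
            _ = _ := by rw [Finset.mul_sum]; exact Finset.sum_congr rfl fun m _ => by ring
      _ = ∑ k ∈ T, signExp (fun e => Real.exp (∑ m, sgn (e m) * (c * w k m))) := by
          rw [prodExp_sum]
      _ ≤ ∑ k ∈ T, Real.exp (c ^ 2 * (r ^ 2 / 2)) := by
          refine Finset.sum_le_sum fun k hk => (signExp_exp_le _).trans (Real.exp_le_exp.2 ?_)
          simp only [mul_pow, ← Finset.mul_sum]
          have := mul_le_mul_of_nonneg_left (hw k hk) (sq_nonneg c)
          linarith
      _ ≤ Real.exp A * Real.exp (c ^ 2 * (r ^ 2 / 2)) := by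
          rw [Finset.sum_const, nsmul_eq_mul]
          exact mul_le_mul_of_nonneg_right hT (Real.exp_pos _).le
      _ = _ := by rw [Real.exp_add]
  have h2 := Real.exp_le_exp.1 h1
  have : A / c + c * (r ^ 2 / 2) = (A + c ^ 2 * (r ^ 2 / 2)) / c := by field_simp
  rw [this, le_div_iff₀ hc]; linarith

/-- Dudley's chaining bound for a class with quadratic metric entropy, over dyadic radii. -/
theorem signExp_chaining {Θ : Type*} (v : Θ → Fin n → ℝ) {ε₀ H : ℝ} (hε : 0 < ε₀) (hH : 0 ≤ H)
    (T : ℕ → Finset Θ) (hT0 : (T 0).card ≤ 1)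
    (hcover : ∀ k θ, ∃ θ' ∈ T k, ∑ m, (v θ m - v θ' m) ^ 2 ≤ (ε₀ / 2 ^ k) ^ 2)
    (hcard : ∀ k, ((T k).card : ℝ) ≤ Real.exp (H ^ 2 / (ε₀ / 2 ^ k) ^ 2)) (k : ℕ) :
    ∀ Φ : (Fin n → Bool) → ℝ, (∀ e, ∃ θ ∈ T k, Φ e ≤ ∑ m, sgn (e m) * v θ m) →
      signExp Φ ≤ k * (2 * √2 * H) := by
  induction k with
  | zero =>
    intro Φ hΦ
    -- The coarsest level has a single point, and a fixed signed sum has mean zero.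
    obtain ⟨θ₀, hθ₀, -⟩ := hΦ fun _ => true
    have : ∀ e, Φ e ≤ ∑ m, sgn (e m) * v θ₀ m := fun e => by
      obtain ⟨θ, hθ, hle⟩ := hΦ e
      rwa [Finset.card_le_one.1 hT0 θ hθ θ₀ hθ₀] at hle
    refine (prodExp_mono half_nonneg this).trans ?_
    have h0 := signExp_sum_eq_zero (v θ₀)
    unfold signExp at h0
    rw [h0]
    simp
  | succ k ih =>
    intro Φ hΦ
    choose θ hθ hle using hΦ
    choose π hπ hdist using hcover k
    set ε := ε₀ / 2 ^ (k + 1) with hεdef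
    have hεp : 0 < ε := by positivity
    have h2ε : ε₀ / 2 ^ k = 2 * ε := by rw [hεdef, pow_succ]; field_simp
    have h1 := ih (fun e => ∑ m, sgn (e m) * v (π (θ e)) m) fun e => ⟨_, hπ _, le_rfl⟩
    -- Each link has length at most `2 * ε`, while the entropy factor is `√2 * H / ε`. The radius
    -- cancels, so every level costs the same `2 * √2 * H`; the number of levels becomes the factor
    -- `log M`.
    have h2 := signExp_le_of_finite (T (k + 1)) (fun θ m => v θ m - v (π θ) m)
      (r := 2 * ε) (A := H ^ 2 / ε ^ 2) (fun θ _ => by rw [← h2ε]; exact hdist θ)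
      (by positivity) (by positivity) (hcard (k + 1))
      (fun e => ∑ m, sgn (e m) * (v (θ e) m - v (π (θ e)) m)) fun e => ⟨_, hθ e, le_rfl⟩
    have h3 : 2 * ε * √(2 * (H ^ 2 / ε ^ 2)) = 2 * √2 * H := by
      rw [Real.sqrt_mul (by norm_num), ← div_pow, Real.sqrt_sq (by positivity)]
      field_simp
    rw [h3] at h2
    calc signExp Φ ≤ signExp (fun e => ∑ m, sgn (e m) * v (π (θ e)) m
            + ∑ m, sgn (e m) * (v (θ e) m - v (π (θ e)) m)) := by
          refine prodExp_mono half_nonneg fun e => (hle e).trans (le_of_eq ?_)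
          rw [← Finset.sum_add_distrib]
          exact Finset.sum_congr rfl fun m _ => by ring
      _ ≤ _ := by
          rw [signExp, prodExp_add]
          push_cast
          unfold signExp at h1 h2
          linarith

end Rademacher

/-! ### Symmetrization and uniform deviations. -/

section Symmetrization

theorem prodExp_comm {Z Y : Type*} [Fintype Z] [Fintype Y] {p : Z → ℝ} {q : Y → ℝ} {n k : ℕ}
    (φ : (Fin n → Z) → (Fin k → Y) → ℝ) :
    prodExp p (fun z => prodExp q (fun y => φ z y)) =
      prodExp q (fun y => prodExp p (fun z => φ z y)) := by
  simp only [prodExp, Finset.mul_sum]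
  rw [Finset.sum_comm]
  exact Finset.sum_congr rfl fun y _ => Finset.sum_congr rfl fun z _ => by ring

variable {Z : Type*} {Θ : Type*} {n : ℕ}

theorem sum_update_sub (w : Fin n → ℝ) (G : Z → ℝ) (z : Fin n → Z) (m : Fin n) (a : Z) :
    ∑ k, w k * G (Function.update z m a k) = ∑ k, w k * G (z k) + w m * (G a - G (z m)) := by
  rw [← sub_eq_iff_eq_add', ← Finset.sum_sub_distrib, Finset.sum_eq_single m]
  · simp; ring
  · intro k _ hk; simp [hk]
  · simp

theorem ciSup_le_ciSup_add [Nonempty Θ] {f h : Θ → ℝ} {c : ℝ} (hb : BddAbove (Set.range h))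
    (hfh : ∀ θ, f θ ≤ h θ + c) : ⨆ θ, f θ ≤ (⨆ θ, h θ) + c :=
  ciSup_le fun θ => (hfh θ).trans (add_le_add_left (le_ciSup hb θ) c)

/-- The supremum of the signed sums of the class `g` over the sample `z`. -/
noncomputable def signedSup (g : Θ → Z → ℝ) (z : Fin n → Z) (e : Fin n → Bool) : ℝ :=
  ⨆ θ, ∑ m, sgn (e m) * g θ (z m)

/-- Empirical Rademacher complexity (not divided by the sample size). -/
noncomputable def empRad (g : Θ → Z → ℝ) (z : Fin n → Z) : ℝ :=
  signExp fun e => signedSup g z e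

variable {p : Z → ℝ} {g : Θ → Z → ℝ} {c : ℝ}

theorem bddAbove_range_signed (hg0 : ∀ θ a, 0 ≤ g θ a) (hgc : ∀ θ a, g θ a ≤ c)
    (z : Fin n → Z) (w : Fin n → ℝ) : BddAbove (Set.range fun θ => ∑ m, w m * g θ (z m)) := by
  refine ⟨∑ m, |w m| * c, ?_⟩
  rintro _ ⟨θ, rfl⟩
  refine Finset.sum_le_sum fun m _ => ?_
  calc w m * g θ (z m) ≤ |w m| * g θ (z m) :=
        mul_le_mul_of_nonneg_right (le_abs_self _) (hg0 _ _)
    _ ≤ _ := mul_le_mul_of_nonneg_left (hgc _ _) (abs_nonneg _)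

theorem abs_diff_le (hg0 : ∀ θ a, 0 ≤ g θ a) (hgc : ∀ θ a, g θ a ≤ c) (θ : Θ) (a b : Z) :
    |g θ a - g θ b| ≤ c :=
  abs_sub_le_iff.2 ⟨by linarith [hg0 θ b, hgc θ a], by linarith [hg0 θ a, hgc θ b]⟩

theorem sum_update_sub_one (G : Z → ℝ) (z : Fin n → Z) (m : Fin n) (a : Z) :
    ∑ k, G (Function.update z m a k) = ∑ k, G (z k) + (G a - G (z m)) := by
  simpa using sum_update_sub (fun _ => 1) G z m a

/-- Exchanges the coordinates of a pair of samples where the sign is negative. -/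
def swapAt (e : Fin n → Bool) (q : (Fin n → Z) × (Fin n → Z)) : (Fin n → Z) × (Fin n → Z) :=
  (fun m => if e m then q.1 m else q.2 m, fun m => if e m then q.2 m else q.1 m)

theorem swapAt_involutive (e : Fin n → Bool) :
    Function.Involutive (swapAt (Z := Z) e) := fun q => by
  refine Prod.ext (funext fun m => ?_) (funext fun m => ?_) <;> by_cases h : e m <;>
    simp [swapAt, h]

theorem signedSup_update_le [Nonempty Θ] (hg0 : ∀ θ a, 0 ≤ g θ a) (hgc : ∀ θ a, g θ a ≤ c)
    (z : Fin n → Z) (m : Fin n) (a : Z) (e : Fin n → Bool) :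
    |signedSup g (Function.update z m a) e - signedSup g z e| ≤ c := by
  have hstep : ∀ θ, |sgn (e m) * (g θ a - g θ (z m))| ≤ c := fun θ => by
    rw [abs_mul, abs_sgn, one_mul]; exact abs_diff_le hg0 hgc θ a (z m)
  refine abs_sub_le_iff.2 ⟨sub_le_iff_le_add'.2 ?_, sub_le_iff_le_add'.2 ?_⟩
  · refine ciSup_le_ciSup_add (bddAbove_range_signed hg0 hgc z fun k => sgn (e k)) fun θ => ?_
    rw [sum_update_sub (fun k => sgn (e k))]
    linarith [(abs_le.1 (hstep θ)).2]
  · refine ciSup_le_ciSup_add (bddAbove_range_signed hg0 hgc _ fun k => sgn (e k)) fun θ => ?_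
    rw [sum_update_sub (fun k => sgn (e k))]
    linarith [(abs_le.1 (hstep θ)).1]

theorem empRad_update_le [Nonempty Θ] (hg0 : ∀ θ a, 0 ≤ g θ a) (hgc : ∀ θ a, g θ a ≤ c)
    (z : Fin n → Z) (m : Fin n) (a : Z) :
    |empRad g (Function.update z m a) - empRad g z| ≤ c := by
  have h := fun e => abs_sub_le_iff.1 (signedSup_update_le hg0 hgc z m a e)
  unfold empRad signExp
  refine abs_sub_le_iff.2 ⟨?_, ?_⟩ <;> rw [← prodExp_sub, ← prodExp_const sum_half (n := n) c]
  · exact prodExp_mono half_nonneg fun e => (h e).1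
  · exact prodExp_mono half_nonneg fun e => (h e).2

variable [Fintype Z]

/-- Mean of `G` under the weights `p`. -/
noncomputable def mean (p : Z → ℝ) (G : Z → ℝ) : ℝ := ∑ a, p a * G a

/-- Largest amount by which a sample sum over the class `g` falls below its expectation. -/
noncomputable def supDev (p : Z → ℝ) (g : Θ → Z → ℝ) (z : Fin n → Z) : ℝ :=
  ⨆ θ, (n * mean p (g θ) - ∑ m, g θ (z m))

theorem mean_le (hp : ∀ a, 0 ≤ p a) (hp1 : ∑ a, p a = 1) {G : Z → ℝ} (hG : ∀ a, G a ≤ c) :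
    mean p G ≤ c := by
  calc mean p G ≤ ∑ a, p a * c :=
        Finset.sum_le_sum fun a _ => mul_le_mul_of_nonneg_left (hG a) (hp a)
    _ = c := by rw [← Finset.sum_mul, hp1, one_mul]

theorem bddAbove_range_dev (hp : ∀ a, 0 ≤ p a) (hp1 : ∑ a, p a = 1) (hg0 : ∀ θ a, 0 ≤ g θ a)
    (hgc : ∀ θ a, g θ a ≤ c) (z : Fin n → Z) :
    BddAbove (Set.range fun θ => n * mean p (g θ) - ∑ m, g θ (z m)) := by
  refine ⟨n * c, ?_⟩
  rintro _ ⟨θ, rfl⟩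
  have h1 : (n : ℝ) * mean p (g θ) ≤ n * c :=
    mul_le_mul_of_nonneg_left (mean_le hp hp1 (hgc θ)) (Nat.cast_nonneg n)
  have h2 : 0 ≤ ∑ m, g θ (z m) := Finset.sum_nonneg fun m _ => hg0 _ _
  simp only
  linarith

theorem supDev_update_le [Nonempty Θ] (hp : ∀ a, 0 ≤ p a) (hp1 : ∑ a, p a = 1)
    (hg0 : ∀ θ a, 0 ≤ g θ a) (hgc : ∀ θ a, g θ a ≤ c) (z : Fin n → Z) (m : Fin n) (a : Z) :
    |supDev p g (Function.update z m a) - supDev p g z| ≤ c := by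
  have hstep := fun θ => abs_le.1 (abs_diff_le hg0 hgc θ a (z m))
  refine abs_sub_le_iff.2 ⟨sub_le_iff_le_add'.2 ?_, sub_le_iff_le_add'.2 ?_⟩
  · refine ciSup_le_ciSup_add (bddAbove_range_dev hp hp1 hg0 hgc z) fun θ => ?_
    rw [sum_update_sub_one]
    linarith [(hstep θ).1]
  · refine ciSup_le_ciSup_add (bddAbove_range_dev hp hp1 hg0 hgc _) fun θ => ?_
    rw [sum_update_sub_one]
    linarith [(hstep θ).2]

/-- The weight of a pair of samples is a product over coordinates, symmetric in the two entries of
each coordinate, and the swap is a bijection. -/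
theorem prodExp_prodExp_swapAt (e : Fin n → Bool) (F : (Fin n → Z) × (Fin n → Z) → ℝ) :
    prodExp p (fun z => prodExp p (fun z' => F (swapAt e (z, z')))) =
      prodExp p (fun z => prodExp p (fun z' => F (z, z'))) := by
  have key : ∀ G : (Fin n → Z) × (Fin n → Z) → ℝ,
      prodExp p (fun z => prodExp p (fun z' => G (z, z'))) =
        ∑ q : (Fin n → Z) × (Fin n → Z), (∏ m, p (q.1 m) * p (q.2 m)) * G q := fun G => by
    rw [Fintype.sum_prod_type]
    simp only [prodExp, Finset.mul_sum, Finset.prod_mul_distrib, mul_assoc]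
  rw [key, key (fun q => F (swapAt e q))]
  conv_rhs => rw [← Equiv.sum_comp (Function.Involutive.toPerm _ (swapAt_involutive e))]
  refine Finset.sum_congr rfl fun q _ => ?_
  change (∏ m, p (q.1 m) * p (q.2 m)) * F (swapAt e q) =
    (∏ m, p ((swapAt e q).1 m) * p ((swapAt e q).2 m)) * F (swapAt e q)
  congr 1
  refine Finset.prod_congr rfl fun m _ => ?_
  by_cases h : e m <;> simp [swapAt, h, mul_comm]

/-- A ghost sample `z'` replaces the mean, by Jensen for the supremum. Averaging over random
coordinate swaps turns the difference of the two sums into a signed sum over `z'` plus one over `z`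
with opposite signs. Both have the same mean, whence the factor 2. -/
theorem prodExp_supDev_le [Nonempty Θ] (hp : ∀ a, 0 ≤ p a) (hp1 : ∑ a, p a = 1)
    (hg0 : ∀ θ a, 0 ≤ g θ a) (hgc : ∀ θ a, g θ a ≤ c) :
    prodExp p (fun z : Fin n → Z => supDev p g z) ≤ 2 * prodExp p (empRad (n := n) g) := by
  set D : (Fin n → Z) × (Fin n → Z) → ℝ :=
    fun q => ⨆ θ, (∑ m, g θ (q.2 m) - ∑ m, g θ (q.1 m)) with hD
  have hDb : ∀ q : (Fin n → Z) × (Fin n → Z),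
      BddAbove (Set.range fun θ => ∑ m, g θ (q.2 m) - ∑ m, g θ (q.1 m)) := fun q => by
    refine ⟨n * c, ?_⟩
    rintro _ ⟨θ, rfl⟩
    have h1 : ∑ m, g θ (q.2 m) ≤ ∑ _m : Fin n, c := Finset.sum_le_sum fun m _ => hgc _ _
    have h2 : 0 ≤ ∑ m, g θ (q.1 m) := Finset.sum_nonneg fun m _ => hg0 _ _
    simp at h1 ⊢
    linarith
  have hghost : prodExp p (fun z : Fin n → Z => supDev p g z)
      ≤ prodExp p (fun z => prodExp p (fun z' => D (z, z'))) := by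
    refine prodExp_mono hp fun z => ciSup_le fun θ => ?_
    have hm : n * mean p (g θ) - ∑ m, g θ (z m)
        = prodExp p (fun z' : Fin n → Z => ∑ m, g θ (z' m) - ∑ m, g θ (z m)) := by
      rw [prodExp_sub, prodExp_const hp1, prodExp_sum]
      simp only [prodExp_eval hp1, mean]
      simp
    rw [hm]
    exact prodExp_mono hp fun z' => le_ciSup (hDb (z, z')) θ
  have hsplit : ∀ (z z' : Fin n → Z) (e : Fin n → Bool),
      D (swapAt e (z, z')) ≤ signedSup g z' e + signedSup g z (fun m => !(e m)) := by
    intro z z' e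
    refine ciSup_le fun θ => ?_
    have h1 := le_ciSup (bddAbove_range_signed hg0 hgc z' fun m => sgn (e m)) θ
    have h2 := le_ciSup (bddAbove_range_signed hg0 hgc z fun m => sgn (!(e m))) θ
    refine le_trans (le_of_eq ?_) (add_le_add h1 h2)
    simp only [← Finset.sum_sub_distrib, ← Finset.sum_add_distrib]
    refine Finset.sum_congr rfl fun m _ => ?_
    cases h : e m <;> simp [swapAt, sgn, h] <;> ring
  refine hghost.trans ?_
  have hE : prodExp p (fun z => prodExp p (fun z' => D (z, z')))
      = signExp (fun e : Fin n → Bool =>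
          prodExp p (fun z => prodExp p (fun z' => D (swapAt e (z, z'))))) := by
    simp only [prodExp_prodExp_swapAt]
    exact (prodExp_const sum_half _).symm
  rw [hE]
  calc _ ≤ signExp (fun e : Fin n → Bool => prodExp p (fun z => prodExp p
            (fun z' => signedSup g z' e + signedSup g z (fun m => !(e m))))) :=
        prodExp_mono half_nonneg fun e => prodExp_mono hp fun z => prodExp_mono hp fun z' =>
          hsplit z z' e
    _ = signExp (fun e : Fin n → Bool => prodExp p (fun z => signedSup g z e)
          + prodExp p (fun z => signedSup g z (fun m => !(e m)))) := by
        simp only [prodExp_add, prodExp_const hp1]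
    _ = 2 * prodExp p (empRad (n := n) g) := by
        have h1 : signExp (fun e : Fin n → Bool => prodExp p (fun z => signedSup g z e))
            = prodExp p (empRad (n := n) g) := prodExp_comm _
        have h2 : signExp (fun e : Fin n → Bool => prodExp p (fun z : Fin n → Z =>
            signedSup g z (fun m => !(e m)))) = prodExp p (empRad (n := n) g) := by
          rw [← h1]
          exact signExp_not (fun e => prodExp p (fun z => signedSup g z e))
        unfold signExp at h1 h2 ⊢
        rw [prodExp_add, h1, h2]; ring

open Classical in
/-- Uniform deviation bound with the empirical Rademacher complexity, together with the deviation
of a fixed member of the class. -/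
theorem sum_weights_deviation_le (hp : ∀ a, 0 ≤ p a) (hp1 : ∑ a, p a = 1)
    (hg0 : ∀ θ a, 0 ≤ g θ a) (hgc : ∀ θ a, g θ a ≤ c) (hc : 0 < c) (hn : 0 < n) (θ₀ : Θ)
    {t : ℝ} (ht : 0 ≤ t) :
    ∑ z : Fin n → Z with ∃ θ, 2 * empRad g z + t <
        (n * mean p (g θ) - ∑ m, g θ (z m)) + (∑ m, g θ₀ (z m) - n * mean p (g θ₀)),
      ∏ m, p (z m) ≤ Real.exp (-(t ^ 2 / (2 * (n * (4 * c) ^ 2)))) := by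
  have : Nonempty Θ := ⟨θ₀⟩
  -- One function carries the uniform deviation, the deviation of `θ₀` and the empirical complexity,
  -- so no union bound is needed. Its differences are at most `c + c + 2 * c`.
  set φ : (Fin n → Z) → ℝ := fun z =>
    supDev p g z + (∑ m, g θ₀ (z m) - n * mean p (g θ₀)) - 2 * empRad g z with hφ
  have hdiff : ∀ z m a, |φ (Function.update z m a) - φ z| ≤ 4 * c := fun z m a => by
    have h1 := abs_le.1 (supDev_update_le hp hp1 hg0 hgc z m a)
    have h2 := abs_le.1 (abs_diff_le hg0 hgc θ₀ a (z m))
    have h3 := abs_le.1 (empRad_update_le hg0 hgc z m a)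
    have h4 := sum_update_sub_one (g θ₀) z m a
    simp only [hφ]
    rw [h4]
    exact abs_le.2 ⟨by linarith [h1.1, h2.1, h3.2], by linarith [h1.2, h2.2, h3.1]⟩
  have hmean : prodExp p φ ≤ 0 := by
    have h1 := prodExp_supDev_le (n := n) hp hp1 hg0 hgc
    have h2 : prodExp p (fun z : Fin n → Z => ∑ m, g θ₀ (z m) - n * mean p (g θ₀)) = 0 := by
      rw [prodExp_sub, prodExp_const hp1, prodExp_sum]
      simp only [prodExp_eval hp1, mean]
      simp
    rw [hφ, prodExp_sub, prodExp_add, h2, prodExp_const_mul]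
    linarith
  refine le_trans ?_ (sum_weights_tail_le hp hp1 (by positivity) hn φ hdiff hmean ht)
  refine Finset.sum_le_sum_of_subset_of_nonneg ?_ fun z _ _ =>
    Finset.prod_nonneg fun m _ => hp (z m)
  intro z hz
  simp only [Finset.mem_filter, Finset.mem_univ, true_and] at hz ⊢
  obtain ⟨θ, hθ⟩ := hz
  have := le_ciSup (bddAbove_range_dev hp hp1 hg0 hgc z) θ
  simp only [hφ, supDev]
  linarith

end Symmetrization

/-! ### From covering numbers to Rademacher complexity. -/

section Complexity

variable {Z : Type*} {Θ : Type*} {n : ℕ} {g : Θ → Z → ℝ} {c : ℝ}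

/-- Entropy bound for the empirical Rademacher complexity. -/
theorem empRad_le_of_cover [Nonempty Θ] (hg0 : ∀ θ a, 0 ≤ g θ a) (hgc : ∀ θ a, g θ a ≤ c)
    (hc : 0 < c) (hn : 0 < n) (z : Fin n → Z) {H : ℝ} (hH : 0 ≤ H)
    (hcover : ∀ ε : ℝ, 0 < ε → ∃ T : Finset Θ, (T.card : ℝ) ≤ Real.exp (H ^ 2 / ε ^ 2) ∧
      ∀ θ, ∃ θ' ∈ T, ∑ m, (g θ (z m) - g θ' (z m)) ^ 2 ≤ ε ^ 2) :
    empRad g z ≤ 2 * c + Nat.log 2 n * (2 * √2 * H) := by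
  have hn' : (0 : ℝ) < n := by exact_mod_cast hn
  set ε₀ := c * √n with hε₀
  have hε₀p : 0 < ε₀ := by positivity
  -- The initial radius `c * √n` bounds the diameter of the class on the sample, so the cover at
  -- level `0` can be replaced by a single point.
  choose T hTc hT using fun k : ℕ => hcover (ε₀ / 2 ^ k) (by positivity)
  obtain ⟨θ₀⟩ := ‹Nonempty Θ›
  set T' : ℕ → Finset Θ := fun k => if k = 0 then {θ₀} else T k with hT'
  have hT'0 : (T' 0).card ≤ 1 := by simp [hT']
  have hT'cover : ∀ k θ, ∃ θ' ∈ T' k,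
      ∑ m, (g θ (z m) - g θ' (z m)) ^ 2 ≤ (ε₀ / 2 ^ k) ^ 2 := by
    intro k θ
    by_cases hk : k = 0
    · subst hk
      refine ⟨θ₀, by simp [hT'], ?_⟩
      calc ∑ m, (g θ (z m) - g θ₀ (z m)) ^ 2 ≤ ∑ _m : Fin n, c ^ 2 := by
            refine Finset.sum_le_sum fun m _ => sq_le_sq' ?_ ?_ <;>
              linarith [hg0 θ (z m), hg0 θ₀ (z m), hgc θ (z m), hgc θ₀ (z m)]
        _ = (ε₀ / 2 ^ 0) ^ 2 := by
            simp [hε₀, mul_pow, Real.sq_sqrt hn'.le, mul_comm]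
    · simpa [hT', hk] using hT k θ
  have hT'card : ∀ k, ((T' k).card : ℝ) ≤ Real.exp (H ^ 2 / (ε₀ / 2 ^ k) ^ 2) := by
    intro k
    by_cases hk : k = 0
    · simp only [hT', hk, if_true, Finset.card_singleton, Nat.cast_one]
      exact Real.one_le_exp (by positivity)
    · simpa [hT', hk] using hTc k
  set k := Nat.log 2 n with hk
  set ε := ε₀ / 2 ^ k with hε
  have hεp : 0 < ε := by positivity
  -- Stopping at level `Nat.log 2 n` makes the last radius at most `2 * c / √n`; by Cauchy–Schwarz,
  -- leaving the class for its finest net then costs at most `2 * c`.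
  have hεn : √n * ε ≤ 2 * c := by
    have h2 : (n : ℝ) < 2 ^ (k + 1) := by exact_mod_cast Nat.lt_pow_succ_log_self (by norm_num) n
    have h3 : √(n : ℝ) * ε = c * n / 2 ^ k := by
      rw [hε, hε₀]
      have := Real.mul_self_sqrt hn'.le
      field_simp
      rw [Real.sq_sqrt hn'.le]
    rw [h3, div_le_iff₀ (by positivity)]
    rw [pow_succ] at h2
    nlinarith
  have : Nonempty Θ := ⟨θ₀⟩
  have hchain := signExp_chaining (fun θ m => g θ (z m)) hε₀p hH T' hT'0 hT'cover hT'card k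
    (fun e => signedSup g z e - √n * ε) fun e => by
      have hne : (T' k).Nonempty := by
        obtain ⟨θ', hθ', -⟩ := hT'cover k θ₀
        exact ⟨θ', hθ'⟩
      obtain ⟨θm, hθm, hmax⟩ := Finset.exists_max_image (T' k)
        (fun θ => ∑ m, sgn (e m) * g θ (z m)) hne
      refine ⟨θm, hθm, sub_le_iff_le_add.2 (ciSup_le fun θ => ?_)⟩
      obtain ⟨θ', hθ', hd⟩ := hT'cover k θ
      have h1 : ∑ m, sgn (e m) * (g θ (z m) - g θ' (z m)) ≤ √n * ε := by
        refine (Real.sum_mul_le_sqrt_mul_sqrt _ _ _).trans ?_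
        have hs : ∀ b : Bool, sgn b ^ 2 = 1 := fun b => by cases b <;> simp [sgn]
        simp only [hs]
        refine mul_le_mul (by simp) ?_ (Real.sqrt_nonneg _) (Real.sqrt_nonneg _)
        exact Real.sqrt_le_iff.2 ⟨hεp.le, hd⟩
      have h2 := hmax θ' hθ'
      simp only [mul_sub, Finset.sum_sub_distrib] at h1
      linarith
  unfold signExp at hchain
  rw [prodExp_sub, prodExp_const sum_half] at hchain
  unfold empRad signExp
  linarith

end Complexity

/-! ### Maurey's method and coverings of convex hulls. -/

/-- Each centre is exchanged for a member of `S` near it, at the price of doubling the radius.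
Centres inside the class are needed both for the norm bounds of later layers and for the range of
the loss. -/
theorem exists_proper_cover {E α : Type*} [SeminormedAddCommGroup E] (S : Set α) (Y : α → E) (F : Finset E) {r : ℝ}
    (h : ∀ A ∈ S, ∃ f ∈ F, ‖Y A - f‖ ≤ r) :
    ∃ T : Finset α, ↑T ⊆ S ∧ T.card ≤ F.card ∧ ∀ A ∈ S, ∃ A' ∈ T, ‖Y A - Y A'‖ ≤ 2 * r := by
  classical
  rcases S.eq_empty_or_nonempty with rfl | ⟨A₀, hA₀⟩
  · exact ⟨∅, by simp, by simp, by simp⟩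
  set pick : E → α := fun f => if hf : ∃ A ∈ S, ‖Y A - f‖ ≤ r then hf.choose else A₀ with hpick
  have hmem : ∀ f, pick f ∈ S := fun f => by
    simp only [hpick]
    split_ifs with hf
    · exact hf.choose_spec.1
    · exact hA₀
  refine ⟨F.image pick, ?_, Finset.card_image_le, fun A hA => ?_⟩
  · intro A hA
    obtain ⟨f, -, rfl⟩ := Finset.mem_image.1 (Finset.mem_coe.1 hA)
    exact hmem f
  · obtain ⟨f, hf, hd⟩ := h A hA
    refine ⟨pick f, Finset.mem_image_of_mem _ hf, ?_⟩
    have hex : ∃ A ∈ S, ‖Y A - f‖ ≤ r := ⟨A, hA, hd⟩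
    have h1 : ‖Y (pick f) - f‖ ≤ r := by
      simp only [hpick, dif_pos hex]
      exact hex.choose_spec.2
    calc ‖Y A - Y (pick f)‖ = ‖(Y A - f) - (Y (pick f) - f)‖ := by congr 1; abel
      _ ≤ ‖Y A - f‖ + ‖Y (pick f) - f‖ := norm_sub_le _ _
      _ ≤ 2 * r := by linarith

section Maurey

variable {E : Type*} [NormedAddCommGroup E] [InnerProductSpace ℝ E] {I : Type*} [Fintype I]

/-- For `i` drawn with weights `w`, the increment `u i - ∑ i, w i • u i` is centred with variance at
most `1`, so the inequality holds on average and hence for some `i`. -/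
theorem exists_norm_add_sq_le (u : I → E) (hu : ∀ i, ‖u i‖ ≤ 1) (w : I → ℝ) (hw : ∀ i, 0 ≤ w i)
    (hw1 : ∑ i, w i = 1) (S : E) :
    ∃ i, ‖S + u i - ∑ i, w i • u i‖ ^ 2 ≤ ‖S‖ ^ 2 + 1 := by
  set ub := ∑ i, w i • u i with hub
  by_contra! hcon
  have hexp : ∀ i, ‖S + u i - ub‖ ^ 2
      = ‖S - ub‖ ^ 2 + 2 * inner ℝ (S - ub) (u i) + ‖u i‖ ^ 2 := fun i => by
    rw [show S + u i - ub = (S - ub) + u i by abel, norm_add_sq_real]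
  have h1 : ∑ i, w i * ‖S + u i - ub‖ ^ 2 ≤ ‖S‖ ^ 2 + 1 := by
    calc ∑ i, w i * ‖S + u i - ub‖ ^ 2
        ≤ ∑ i, (w i * (‖S - ub‖ ^ 2 + 1) + 2 * (w i * inner ℝ (S - ub) (u i))) := by
          refine Finset.sum_le_sum fun i _ => ?_
          rw [hexp]
          have h2 : ‖u i‖ ^ 2 ≤ 1 := pow_le_one₀ (norm_nonneg _) (hu i)
          nlinarith [hw i]
      _ = (‖S - ub‖ ^ 2 + 1) + 2 * inner ℝ (S - ub) ub := by
          rw [Finset.sum_add_distrib, ← Finset.sum_mul, hw1, ← Finset.mul_sum, one_mul]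
          congr 2
          rw [hub, inner_sum]
          simp only [inner_smul_right]
      _ ≤ ‖S‖ ^ 2 + 1 := by
          have h3 : ‖S‖ ^ 2 = ‖S - ub‖ ^ 2 + 2 * inner ℝ (S - ub) ub + ‖ub‖ ^ 2 := by
            rw [← norm_add_sq_real, sub_add_cancel]
          have := sq_nonneg ‖ub‖
          linarith
  have h4 : ∑ i, w i * (‖S + u i - ub‖ ^ 2 - (‖S‖ ^ 2 + 1)) = 0 := by
    refine le_antisymm ?_ (Finset.sum_nonneg fun i _ =>
      mul_nonneg (hw i) (sub_nonneg.2 (hcon i).le))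
    simp only [mul_sub, Finset.sum_sub_distrib]
    rw [← Finset.sum_mul, hw1]; linarith
  rw [Finset.sum_eq_zero_iff_of_nonneg fun i _ =>
    mul_nonneg (hw i) (sub_nonneg.2 (hcon i).le)] at h4
  have h5 : ∀ i, w i = 0 := fun i =>
    (mul_eq_zero.1 (h4 i (Finset.mem_univ i))).resolve_right (sub_pos.2 (hcon i)).ne'
  simp [h5] at hw1

/-- Maurey's empirical method: `k` atoms approximate `k` times a convex combination. -/
theorem exists_sum_atoms_near (u : I → E) (hu : ∀ i, ‖u i‖ ≤ 1) (w : I → ℝ) (hw : ∀ i, 0 ≤ w i)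
    (hw1 : ∑ i, w i = 1) (k : ℕ) :
    ∃ s : Fin k → I, ‖∑ r, u (s r) - (k : ℝ) • ∑ i, w i • u i‖ ^ 2 ≤ k := by
  induction k with
  | zero => exact ⟨Fin.elim0, by simp⟩
  | succ k ih =>
    obtain ⟨s, hs⟩ := ih
    obtain ⟨i, hi⟩ := exists_norm_add_sq_le u hu w hw hw1
      (∑ r, u (s r) - (k : ℝ) • ∑ i, w i • u i)
    refine ⟨Fin.cons i s, ?_⟩
    rw [Fin.sum_univ_succ]
    simp only [Fin.cons_zero, Fin.cons_succ]
    push_cast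
    rw [show u i + ∑ r, u (s r) - ((k : ℝ) + 1) • ∑ i, w i • u i
      = ∑ r, u (s r) - (k : ℝ) • ∑ i, w i • u i + u i - ∑ i, w i • u i by
        rw [add_smul, one_smul]; abel]
    linarith

/-- The coefficients become a probability on signed atoms: `q` adds the slack `1 - ∑ i, |a i|`
uniformly to `|a i|`, and `q i` is divided between the two signs so that their difference is `a i`.
-/
theorem exists_signed_sum_atoms_near [Nonempty I] (u : I → E) (hu : ∀ i, ‖u i‖ ≤ 1) (a : I → ℝ)
    (ha : ∑ i, |a i| ≤ 1) (k : ℕ) :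
    ∃ s : Fin k → I × Bool,
      ‖∑ r, sgn (s r).2 • u (s r).1 - (k : ℝ) • ∑ i, a i • u i‖ ^ 2 ≤ k := by
  have hI : (0 : ℝ) < Fintype.card I := by exact_mod_cast Fintype.card_pos
  set q : I → ℝ := fun i => |a i| + (1 - ∑ i, |a i|) / Fintype.card I with hq
  have hqa : ∀ i, |a i| ≤ q i := fun i => by
    have : 0 ≤ (1 - ∑ i, |a i|) / Fintype.card I := div_nonneg (by linarith) hI.le
    simp only [hq]; linarith
  have hq1 : ∑ i, q i = 1 := by
    simp only [hq, Finset.sum_add_distrib, Finset.sum_const, Finset.card_univ, nsmul_eq_mul]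
    field_simp
    ring
  have key := exists_sum_atoms_near (fun x : I × Bool => sgn x.2 • u x.1)
    (fun x => by rw [norm_smul, Real.norm_eq_abs, abs_sgn, one_mul]; exact hu x.1)
    (fun x => (q x.1 + sgn x.2 * a x.1) / 2)
    (fun x => by
      have h1 := hqa x.1
      have h2 : |sgn x.2 * a x.1| ≤ |a x.1| := by rw [abs_mul, abs_sgn, one_mul]
      have h3 := (abs_le.1 h2).1
      linarith)
    (by
      rw [Fintype.sum_prod_type, ← hq1]
      refine Finset.sum_congr rfl fun i _ => ?_
      simp [sgn]; ring) k
  have hsum : ∑ x : I × Bool, ((q x.1 + sgn x.2 * a x.1) / 2) • sgn x.2 • u x.1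
      = ∑ i, a i • u i := by
    rw [Fintype.sum_prod_type]
    refine Finset.sum_congr rfl fun i _ => ?_
    simp only [Fintype.sum_bool, sgn, smul_smul, ← add_smul]
    congr 1
    simp; ring
  rwa [hsum] at key

/-- Covering number of a scaled `ℓ¹` hull of finitely many atoms. -/
theorem exists_cover_hull [Nonempty I] (u : I → E) (hu : ∀ i, ‖u i‖ ≤ 1) {C t : ℝ} (hC : 0 ≤ C)
    (ht : 0 < t) :
    ∃ F : Finset E, (F.card : ℝ) ≤ Real.exp (2 / t ^ 2 * Real.log (2 * Fintype.card I)) ∧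
      ∀ a : I → ℝ, ∑ i, |a i| ≤ C → ∃ f ∈ F, ‖∑ i, a i • u i - f‖ ≤ t * C := by
  classical
  have hI : (1 : ℝ) ≤ Fintype.card I := by exact_mod_cast Fintype.card_pos
  have hlog : 0 ≤ Real.log (2 * Fintype.card I) := Real.log_nonneg (by linarith)
  by_cases ht1 : 1 ≤ t
  · refine ⟨{0}, by simpa using Real.one_le_exp (by positivity), fun a ha => ⟨0, by simp, ?_⟩⟩
    rw [sub_zero]
    calc ‖∑ i, a i • u i‖ ≤ ∑ i, ‖a i • u i‖ := norm_sum_le _ _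
      _ ≤ ∑ i, |a i| := Finset.sum_le_sum fun i _ => by
          rw [norm_smul, Real.norm_eq_abs]
          exact mul_le_of_le_one_right (abs_nonneg _) (hu i)
      _ ≤ C := ha
      _ ≤ t * C := le_mul_of_one_le_left hC ht1
  -- Averages of `k = ⌈1 / t ^ 2⌉₊` signed atoms reach relative accuracy `1 / √k ≤ t`. Since `t <
  -- 1`, rounding up at most doubles the exponent, giving `2 / t ^ 2`.
  · push Not at ht1
    have h1t : 1 < 1 / t ^ 2 := by
      rw [one_lt_div (by positivity)]; nlinarith
    set k := ⌈1 / t ^ 2⌉₊ with hk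
    have hk1 : 1 / t ^ 2 ≤ k := Nat.le_ceil _
    have hk2 : (k : ℝ) ≤ 2 / t ^ 2 := by
      have := Nat.ceil_lt_add_one (a := 1 / t ^ 2) (by positivity)
      have e : 2 / t ^ 2 = 1 / t ^ 2 + 1 / t ^ 2 := by ring
      rw [e]; linarith
    have hk0 : (0 : ℝ) < k := by linarith
    refine ⟨Finset.univ.image fun s : Fin k → I × Bool =>
      (C / k) • ∑ r, sgn (s r).2 • u (s r).1, ?_, fun a ha => ?_⟩
    · have h1 : ((Finset.univ.image fun s : Fin k → I × Bool =>
          (C / k) • ∑ r, sgn (s r).2 • u (s r).1).card : ℝ) ≤ (2 * Fintype.card I : ℝ) ^ k := by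
        refine (Nat.cast_le.2 Finset.card_image_le).trans (le_of_eq ?_)
        simp [mul_comm]
      refine h1.trans ?_
      rw [← Real.exp_log (show (0 : ℝ) < 2 * Fintype.card I by linarith), ← Real.exp_nat_mul,
        Real.exp_log (show (0 : ℝ) < 2 * Fintype.card I by linarith)]
      exact Real.exp_le_exp.2 (mul_le_mul_of_nonneg_right hk2 hlog)
    · have hCa : ∀ i, C * (a i / C) = a i := fun i => by
        rcases hC.eq_or_lt with rfl | hC'
        · have h0 : |a i| ≤ 0 :=
            (Finset.single_le_sum (f := fun i => |a i|) (fun i _ => abs_nonneg _)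
              (Finset.mem_univ i)).trans ha
          rw [abs_nonpos_iff.1 h0]; simp
        · field_simp
      obtain ⟨s, hs⟩ := exists_signed_sum_atoms_near u hu (fun i => a i / C) (by
        simp only [abs_div, abs_of_nonneg hC, ← Finset.sum_div]
        exact div_le_one_of_le₀ ha hC) k
      refine ⟨_, Finset.mem_image_of_mem _ (Finset.mem_univ s), ?_⟩
      have e1 : ∑ i, a i • u i - (C / k) • ∑ r, sgn (s r).2 • u (s r).1
          = -(C / k) • (∑ r, sgn (s r).2 • u (s r).1 - (k : ℝ) • ∑ i, (a i / C) • u i) := by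
        rw [smul_sub, smul_smul, neg_mul, div_mul_cancel₀ _ hk0.ne', neg_smul C, sub_neg_eq_add,
          Finset.smul_sum (r := C)]
        simp only [smul_smul, hCa, neg_smul]
        abel
      rw [e1, norm_smul, Real.norm_eq_abs, abs_neg, abs_of_nonneg (by positivity)]
      have h2 : ‖∑ r, sgn (s r).2 • u (s r).1 - (k : ℝ) • ∑ i, (a i / C) • u i‖ ≤ t * k := by
        refine (pow_le_pow_iff_left₀ (norm_nonneg _) (by positivity) two_ne_zero).1 (hs.trans ?_)
        have h3 : 1 ≤ k * t ^ 2 := by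
          rwa [div_le_iff₀ (by positivity)] at hk1
        nlinarith
      calc C / k * _ ≤ C / k * (t * k) := mul_le_mul_of_nonneg_left h2 (by positivity)
        _ = t * C := by field_simp

end Maurey

/-! ### Covering the action of a class of matrices on a finite family. -/

section MatrixCover

variable {ι : Type*} [Fintype ι]

/-- `ℓ²` norm of a finite family of vectors. -/
noncomputable def famNorm {d : ℕ} (h : ι → Vec d) : ℝ :=
  ‖(WithLp.toLp 2 h : PiLp 2 fun _ : ι => Vec d)‖

theorem famNorm_sq {d : ℕ} (h : ι → Vec d) : famNorm h ^ 2 = ∑ a, ‖h a‖ ^ 2 := by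
  rw [famNorm, PiLp.norm_sq_eq_of_L2]

theorem famNorm_nonneg {d : ℕ} (h : ι → Vec d) : 0 ≤ famNorm h := norm_nonneg _

theorem famNorm_add_le {d : ℕ} (h h' : ι → Vec d) :
    famNorm (fun a => h a + h' a) ≤ famNorm h + famNorm h' :=
  norm_add_le (WithLp.toLp 2 h : PiLp 2 fun _ : ι => Vec d) (WithLp.toLp 2 h')

theorem famNorm_le_mul {d d' : ℕ} {h : ι → Vec d} {h' : ι → Vec d'} {c : ℝ} (hc : 0 ≤ c)
    (hle : ∀ a, ‖h a‖ ≤ c * ‖h' a‖) : famNorm h ≤ c * famNorm h' := by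
  refine (pow_le_pow_iff_left₀ (famNorm_nonneg _) (mul_nonneg hc (famNorm_nonneg _))
    two_ne_zero).1 ?_
  rw [mul_pow, famNorm_sq, famNorm_sq, Finset.mul_sum]
  refine Finset.sum_le_sum fun a _ => ?_
  rw [← mul_pow]
  exact pow_le_pow_left₀ (norm_nonneg _) (hle a) 2

/-- Norm of the `j`-th coordinates of a family of vectors. -/
noncomputable def coordNorm {d : ℕ} (h : ι → Vec d) (j : Fin d) : ℝ := √(∑ a, h a j ^ 2)

theorem coordNorm_nonneg {d : ℕ} (h : ι → Vec d) (j : Fin d) : 0 ≤ coordNorm h j :=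
  Real.sqrt_nonneg _

theorem sum_coordNorm_sq {d : ℕ} (h : ι → Vec d) :
    ∑ j, coordNorm h j ^ 2 = famNorm h ^ 2 := by
  simp only [famNorm_sq, EuclideanSpace.real_norm_sq_eq, coordNorm]
  rw [Finset.sum_comm]
  exact Finset.sum_congr rfl fun j _ => Real.sq_sqrt (Finset.sum_nonneg fun a _ => sq_nonneg _)

/-- If the norm vanishes so do all the coordinates `h a j`, so the convention for division by zero
is harmless. -/
theorem coordNorm_mul_div {d : ℕ} (h : ι → Vec d) (j : Fin d) (a : ι) :
    coordNorm h j * (h a j / coordNorm h j) = h a j := by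
  by_cases hc : coordNorm h j = 0
  · rw [coordNorm, Real.sqrt_eq_zero (Finset.sum_nonneg fun a _ => sq_nonneg _),
      Finset.sum_eq_zero_iff_of_nonneg fun a _ => sq_nonneg _] at hc
    rw [pow_eq_zero_iff two_ne_zero |>.1 (hc a (Finset.mem_univ a))]; simp
  · field_simp

/-- Normalized image of the family `h` under the elementary matrix with entry `(i, j)`. -/
noncomputable def matAtom {m d : ℕ} (h : ι → Vec d) (x : Fin m × Fin d) :
    PiLp 2 fun _ : ι => Vec m :=
  WithLp.toLp 2 fun a => (h a x.2 / coordNorm h x.2) • EuclideanSpace.single x.1 (1 : ℝ)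

theorem norm_matAtom_le {m d : ℕ} (h : ι → Vec d) (x : Fin m × Fin d) : ‖matAtom h x‖ ≤ 1 := by
  refine (pow_le_pow_iff_left₀ (norm_nonneg _) zero_le_one two_ne_zero).1 ?_
  rw [PiLp.norm_sq_eq_of_L2]
  simp only [matAtom, norm_smul, Real.norm_eq_abs, PiLp.norm_single, norm_one,
    mul_one, sq_abs]
  simp only [div_pow, ← Finset.sum_div]
  rw [coordNorm, Real.sq_sqrt (Finset.sum_nonneg fun a _ => sq_nonneg _), one_pow]
  exact div_self_le_one _

theorem sum_smul_matAtom {m d : ℕ} (h : ι → Vec d) (A : Matrix (Fin m) (Fin d) ℝ) :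
    ∑ x : Fin m × Fin d, (A x.1 x.2 * coordNorm h x.2) • matAtom h x
      = WithLp.toLp 2 fun a => Matrix.toEuclideanLin A (h a) := by
  ext a i
  simp only [matAtom, WithLp.ofLp_sum, WithLp.ofLp_smul, Finset.sum_apply, Pi.smul_apply,
    smul_smul, mul_assoc, coordNorm_mul_div]
  simp [Fintype.sum_prod_type, Matrix.toLpLin_apply, Matrix.mulVec, dotProduct]

/-- Cauchy–Schwarz in each row of `A`. This is where the `(2,1)` norm of the transpose enters: it
controls the `ℓ¹` norm of the coefficients in `sum_smul_matAtom`. -/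
theorem sum_abs_mul_coordNorm_le {m d : ℕ} (h : ι → Vec d) (A : Matrix (Fin m) (Fin d) ℝ) :
    ∑ x : Fin m × Fin d, |A x.1 x.2 * coordNorm h x.2| ≤ twoOneNorm A.transpose * famNorm h := by
  rw [Fintype.sum_prod_type, twoOneNorm, Finset.sum_mul]
  refine Finset.sum_le_sum fun i _ => ?_
  have h1 := Real.sum_mul_le_sqrt_mul_sqrt Finset.univ (fun j => |A i j|) (coordNorm h)
  rw [sum_coordNorm_sq, Real.sqrt_sq (famNorm_nonneg h)] at h1
  simpa [abs_mul, abs_of_nonneg (coordNorm_nonneg h _)] using h1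

/-- Proper covering of the images of a family of vectors under a class of matrices. -/
theorem exists_matrix_cover {m d D : ℕ} (hm : m ≤ D) (hd : d ≤ D) (hD : 1 ≤ D) (h : ι → Vec d)
    (S : Set (Matrix (Fin m) (Fin d) ℝ)) (A₀ : Matrix (Fin m) (Fin d) ℝ) {b t : ℝ}
    (hS : ∀ A ∈ S, twoOneNorm (A.transpose - A₀.transpose) ≤ b) (hb : 0 ≤ b) (ht : 0 ≤ t)
    (htb : t = 0 → b = 0) :
    ∃ T : Finset (Matrix (Fin m) (Fin d) ℝ), ↑T ⊆ S ∧
      (T.card : ℝ) ≤ Real.exp (2 / t ^ 2 * Real.log (2 * (D : ℝ) ^ 2)) ∧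
      ∀ A ∈ S, ∃ A' ∈ T, famNorm (fun a => Matrix.toEuclideanLin A (h a) -
        Matrix.toEuclideanLin A' (h a)) ≤ 2 * (t * (b * famNorm h)) := by
  have hD' : (1 : ℝ) ≤ D := by exact_mod_cast hD
  have hlog : 0 ≤ Real.log (2 * (D : ℝ) ^ 2) := Real.log_nonneg (by nlinarith)
  have hsub : S.Subsingleton → ∃ T : Finset (Matrix (Fin m) (Fin d) ℝ), ↑T ⊆ S ∧
      (T.card : ℝ) ≤ Real.exp (2 / t ^ 2 * Real.log (2 * (D : ℝ) ^ 2)) ∧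
      ∀ A ∈ S, ∃ A' ∈ T, famNorm (fun a => Matrix.toEuclideanLin A (h a) -
        Matrix.toEuclideanLin A' (h a)) ≤ 2 * (t * (b * famNorm h)) := by
    intro hSs
    rcases S.eq_empty_or_nonempty with rfl | ⟨B, hB⟩
    · exact ⟨∅, by simp, by simpa using (Real.exp_pos _).le, by simp⟩
    · refine ⟨{B}, by simpa using hB, by simpa using Real.one_le_exp (by positivity),
        fun A hA => ⟨B, by simp, ?_⟩⟩
      have h0 : famNorm (fun a => Matrix.toEuclideanLin A (h a) - Matrix.toEuclideanLin B (h a))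
          ≤ 0 := by
        have h1 := famNorm_le_mul (ι := ι) (h := fun a =>
          Matrix.toEuclideanLin A (h a) - Matrix.toEuclideanLin B (h a)) (h' := h) le_rfl
          fun a => by rw [hSs hA hB]; simp
        simpa using h1
      have := famNorm_nonneg h
      exact h0.trans (by positivity)
  -- For `t = 0` the stated cardinality bound reads `exp 0 = 1`, because `2 / 0 = 0`. Then `b = 0`
  -- forces `S` to contain at most `A₀`.
  rcases ht.eq_or_lt with rfl | ht'
  · obtain rfl := htb rfl
    have hS0 : ∀ A ∈ S, A = A₀ := by
      intro A hA
      have h1 := hS A hA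
      have h2 : ∑ i, √(∑ j, (A.transpose - A₀.transpose) j i ^ 2) = 0 :=
        le_antisymm h1 (Finset.sum_nonneg fun i _ => Real.sqrt_nonneg _)
      rw [Finset.sum_eq_zero_iff_of_nonneg fun i _ => Real.sqrt_nonneg _] at h2
      ext i j
      have h3 := h2 i (Finset.mem_univ i)
      rw [Real.sqrt_eq_zero (Finset.sum_nonneg fun j _ => sq_nonneg _),
        Finset.sum_eq_zero_iff_of_nonneg fun j _ => sq_nonneg _] at h3
      have h4 := pow_eq_zero_iff two_ne_zero |>.1 (h3 j (Finset.mem_univ j))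
      simpa [sub_eq_zero] using h4
    exact hsub fun A hA B hB => (hS0 A hA).trans (hS0 B hB).symm
  · rcases isEmpty_or_nonempty (Fin m × Fin d) with hI | hI
    · refine hsub fun A _ B _ => ?_
      ext i j
      exact (hI.false (i, j)).elim
    · obtain ⟨F, hFc, hF⟩ := exists_cover_hull (matAtom (m := m) h) (norm_matAtom_le h)
        (mul_nonneg hb (famNorm_nonneg h)) ht'
      obtain ⟨T, hTS, hTc, hT⟩ := exists_proper_cover S
        (fun A => (WithLp.toLp 2 fun a => Matrix.toEuclideanLin (A - A₀) (h a) :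
          PiLp 2 fun _ : ι => Vec m)) F (r := t * (b * famNorm h)) fun A hA => by
          have h1 := sum_abs_mul_coordNorm_le h (A - A₀)
          rw [Matrix.transpose_sub] at h1
          rw [← sum_smul_matAtom]
          exact hF (fun x => (A - A₀) x.1 x.2 * coordNorm h x.2)
            (h1.trans (mul_le_mul_of_nonneg_right (hS A hA) (famNorm_nonneg h)))
      refine ⟨T, hTS, ?_, fun A hA => ?_⟩
      · refine (Nat.cast_le.2 hTc).trans (hFc.trans (Real.exp_le_exp.2 ?_))
        refine mul_le_mul_of_nonneg_left (Real.log_le_log ?_ ?_) (by positivity)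
        · have : (0 : ℝ) < Fintype.card (Fin m × Fin d) := by exact_mod_cast Fintype.card_pos
          positivity
        · have h1 : m * d ≤ D ^ 2 := by rw [sq]; exact Nat.mul_le_mul hm hd
          have h2 : ((m * d : ℕ) : ℝ) ≤ (D : ℝ) ^ 2 := by exact_mod_cast h1
          simp only [Fintype.card_prod, Fintype.card_fin]
          linarith
      · obtain ⟨A', hA', hd'⟩ := hT A hA
        refine ⟨A', hA', le_trans (le_of_eq ?_) hd'⟩
        rw [← WithLp.toLp_sub, famNorm]
        congr 2
        funext a
        simp

end MatrixCover

theorem norm_toEuclideanLin_le {m n : ℕ} (A : Matrix (Fin m) (Fin n) ℝ) (v : Vec n) :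
    ‖Matrix.toEuclideanLin A v‖ ≤ matSpectralNorm A * ‖v‖ :=
  ContinuousLinearMap.le_opNorm (LinearMap.toContinuousLinearMap (Matrix.toEuclideanLin A)) v

/-! ### Covering numbers of the network class. -/

namespace NetSpec

variable {L : ℕ} (net : NetSpec L)

theorem layer_succ (A : net.Weights) (u : Vec net.inDim) (l : Fin L) :
    net.layer A u l.succ = net.act l (Matrix.toEuclideanLin (A l) (net.layer A u l.castSucc)) :=
  rfl

theorem layer_congr {A B : net.Weights} (u : Vec net.inDim) (l : Fin (L + 1))
    (h : ∀ k : Fin L, k.castSucc < l → A k = B k) : net.layer A u l = net.layer B u l := by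
  induction l using Fin.induction with
  | zero => rfl
  | succ l ih =>
    rw [layer_succ, layer_succ, h l Fin.castSucc_lt_succ,
      ih fun k hk => h k (hk.trans Fin.castSucc_lt_succ)]

theorem norm_act_le (l : Fin L) (v : Vec (net.width l.succ)) :
    ‖net.act l v‖ ≤ net.lip l * ‖v‖ := by
  have := (net.act_lipschitz l).dist_le_mul v 0
  rwa [net.act_zero, dist_zero_right, dist_zero_right] at this

/-- The layers that act before position `l`. -/
def before (l : Fin (L + 1)) : Finset (Fin L) := Finset.univ.filter fun k => k.castSucc < l

theorem before_zero : before (0 : Fin (L + 1)) = ∅ := by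
  simp [before]

theorem before_succ (l : Fin L) : before l.succ = insert l (before l.castSucc) := by
  ext k
  simp only [before, Finset.mem_filter, Finset.mem_univ, true_and, Finset.mem_insert,
    Fin.lt_def, Fin.val_castSucc, Fin.val_succ, Fin.ext_iff]
  omega

theorem notMem_before (l : Fin L) : l ∉ before l.castSucc := by
  simp [before]

theorem before_last : before (Fin.last L) = Finset.univ := by
  simp [before, Fin.castSucc_lt_last]

/-- Lipschitz bound for the first layers. -/
noncomputable def lipBefore (l : Fin (L + 1)) : ℝ := ∏ k ∈ before l, net.s k * net.lip k

theorem lipBefore_nonneg (l : Fin (L + 1)) : 0 ≤ net.lipBefore l :=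
  Finset.prod_nonneg fun k _ => mul_nonneg (net.s_pos k).le (net.lip k).coe_nonneg

theorem lipBefore_succ (l : Fin L) :
    net.lipBefore l.succ = net.s l * net.lip l * net.lipBefore l.castSucc := by
  rw [lipBefore, before_succ, Finset.prod_insert (notMem_before l), lipBefore]

theorem norm_layer_le {A : net.Weights} (hA : A ∈ net.params) (u : Vec net.inDim)
    (l : Fin (L + 1)) : ‖net.layer A u l‖ ≤ net.lipBefore l * ‖u‖ := by
  induction l using Fin.induction with
  | zero => simp [lipBefore, before_zero, layer]
  | succ l ih =>
    rw [layer_succ, lipBefore_succ]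
    calc _ ≤ net.lip l * ‖Matrix.toEuclideanLin (A l) (net.layer A u l.castSucc)‖ :=
          net.norm_act_le l _
      _ ≤ net.lip l * (net.s l * (net.lipBefore l.castSucc * ‖u‖)) := by
          refine mul_le_mul_of_nonneg_left ?_ (net.lip l).coe_nonneg
          refine (norm_toEuclideanLin_le _ _).trans ?_
          exact mul_le_mul (hA l).1 ih (norm_nonneg _) (net.s_pos l).le
      _ = _ := by ring

variable {ι : Type*} [Fintype ι]

theorem famNorm_layer_succ_sub_le {A B : net.Weights} (hA : A ∈ net.params)
    (u : ι → Vec net.inDim) (l : Fin L) :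
    famNorm (fun a => net.layer A (u a) l.succ - net.layer B (u a) l.succ) ≤
      net.lip l * (net.s l *
        famNorm (fun a => net.layer A (u a) l.castSucc - net.layer B (u a) l.castSucc) +
        famNorm (fun a => Matrix.toEuclideanLin (A l) (net.layer B (u a) l.castSucc) -
          Matrix.toEuclideanLin (B l) (net.layer B (u a) l.castSucc))) := by
  have h1 : famNorm (fun a => net.layer A (u a) l.succ - net.layer B (u a) l.succ) ≤
      net.lip l * famNorm (fun a => Matrix.toEuclideanLin (A l) (net.layer A (u a) l.castSucc) -
        Matrix.toEuclideanLin (B l) (net.layer B (u a) l.castSucc)) := by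
    refine famNorm_le_mul (net.lip l).coe_nonneg fun a => ?_
    rw [layer_succ, layer_succ, ← dist_eq_norm, ← dist_eq_norm]
    exact (net.act_lipschitz l).dist_le_mul _ _
  refine h1.trans (mul_le_mul_of_nonneg_left ?_ (net.lip l).coe_nonneg)
  have h2 : famNorm (fun a => Matrix.toEuclideanLin (A l)
      (net.layer A (u a) l.castSucc - net.layer B (u a) l.castSucc)) ≤ net.s l *
      famNorm (fun a => net.layer A (u a) l.castSucc - net.layer B (u a) l.castSucc) := by
    refine famNorm_le_mul (net.s_pos l).le fun a => ?_
    exact (norm_toEuclideanLin_le _ _).trans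
      (mul_le_mul_of_nonneg_right (hA l).1 (norm_nonneg _))
  refine le_trans (le_of_eq ?_) ((famNorm_add_le _ _).trans (add_le_add_left h2 _))
  congr 1
  funext a
  rw [map_sub]
  abel

/-- Covering of the outputs of the first layers, with radii `t k` in the individual layers. -/
theorem exists_layer_cover (hD : 1 ≤ net.maxWidth) (hne : net.params.Nonempty)
    (u : ι → Vec net.inDim) (t : Fin L → ℝ) (ht : ∀ k, 0 ≤ t k)
    (htb : ∀ k, t k = 0 → net.b k = 0) (l : Fin (L + 1)) :
    ∃ T : Finset net.Weights, ↑T ⊆ net.params ∧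
      (T.card : ℝ) ≤
        Real.exp (∑ k ∈ before l, 2 / t k ^ 2 * Real.log (2 * (net.maxWidth : ℝ) ^ 2)) ∧
      ∀ A ∈ net.params, ∃ B ∈ T,
        famNorm (fun a => net.layer A (u a) l - net.layer B (u a) l) ≤
          2 * (net.lipBefore l * famNorm u) * ∑ k ∈ before l, t k * (net.b k / net.s k) := by
  classical
  induction l using Fin.induction with
  | zero =>
    obtain ⟨A₀, hA₀⟩ := hne
    refine ⟨{A₀}, by simpa using hA₀, by simp [before_zero], fun A _ => ⟨A₀, by simp, ?_⟩⟩
    simp [before_zero, layer, famNorm]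
    rfl
  | succ l ih =>
    obtain ⟨T, hTp, hTc, hT⟩ := ih
    set Sl : Set (Matrix (Fin (net.width l.succ)) (Fin (net.width l.castSucc)) ℝ) :=
      {A | matSpectralNorm A ≤ net.s l ∧
        twoOneNorm (A.transpose - (net.ref l).transpose) ≤ net.b l} with hSl
    -- The cover of layer `l` depends on the centre `B` of the earlier layers, since it is taken on
    -- the outputs that `B` produces. Its cardinality bound does not, so the cardinalities multiply.
    choose C hCS hCc hC using fun B : net.Weights =>
      exists_matrix_cover (net.width_le l.succ) (net.width_le l.castSucc) hD
        (fun a => net.layer B (u a) l.castSucc) Sl (net.ref l) (fun A hA => hA.2)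
        (net.b_nonneg l) (ht l) (htb l)
    refine ⟨T.biUnion fun B => (C B).image (Function.update B l), ?_, ?_, fun A hA => ?_⟩
    · intro A hA
      simp only [Finset.coe_biUnion, Finset.coe_image, Set.mem_iUnion, Set.mem_image] at hA
      obtain ⟨B, hB, A', hA', rfl⟩ := hA
      intro k
      by_cases hk : k = l
      · subst hk
        rw [Function.update_self]
        exact hCS B hA'
      · rw [Function.update_of_ne hk]
        exact hTp hB k
    · rw [before_succ, Finset.sum_insert (notMem_before l), add_comm, Real.exp_add]
      set q := Real.exp (2 / t l ^ 2 * Real.log (2 * (net.maxWidth : ℝ) ^ 2)) with hq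
      calc ((T.biUnion fun B => (C B).image (Function.update B l)).card : ℝ)
          ≤ ∑ B ∈ T, (((C B).image (Function.update B l)).card : ℝ) := by
            exact_mod_cast Finset.card_biUnion_le
        _ ≤ ∑ _B ∈ T, q := Finset.sum_le_sum fun B _ =>
            (Nat.cast_le.2 Finset.card_image_le).trans (hCc B)
        _ = T.card * q := by rw [Finset.sum_const, nsmul_eq_mul]
        _ ≤ _ := mul_le_mul_of_nonneg_right hTc (Real.exp_pos _).le
    · obtain ⟨B, hB, hAB⟩ := hT A hA
      obtain ⟨A', hA', hd⟩ := hC B (A l) (hA l)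
      refine ⟨Function.update B l A', Finset.mem_biUnion.2
        ⟨B, hB, Finset.mem_image_of_mem _ hA'⟩, ?_⟩
      have hBl : ∀ a, net.layer (Function.update B l A') (u a) l.castSucc
          = net.layer B (u a) l.castSucc := fun a => by
        refine net.layer_congr _ _ fun k hk => Function.update_of_ne ?_ _ _
        rintro rfl
        exact lt_irrefl _ hk
      refine (net.famNorm_layer_succ_sub_le hA u l).trans ?_
      simp only [hBl, Function.update_self]
      have hBn : famNorm (fun a => net.layer B (u a) l.castSucc)
          ≤ net.lipBefore l.castSucc * famNorm u :=
        famNorm_le_mul (net.lipBefore_nonneg _) fun a => net.norm_layer_le (hTp hB) _ _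
      have hs := net.s_pos l
      have htl := ht l
      have hbl := net.b_nonneg l
      have hlip := (net.lip l).coe_nonneg
      calc _ ≤ (net.lip l : ℝ) * (net.s l * (2 * (net.lipBefore l.castSucc * famNorm u) *
              ∑ k ∈ before l.castSucc, t k * (net.b k / net.s k)) +
              2 * (t l * (net.b l * (net.lipBefore l.castSucc * famNorm u)))) := by
            gcongr
            exact hd.trans (by gcongr)
        _ = _ := by
            rw [before_succ, Finset.sum_insert (notMem_before l), lipBefore_succ]
            field_simp
            ring

/-- Covering number of the network class in the `ℓ²` norm over finitely many inputs. -/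
theorem exists_eval_cover (hD : 1 ≤ net.maxWidth) (hne : net.params.Nonempty)
    (u : ι → Vec net.inDim) {ε : ℝ} (hε : 0 < ε) :
    ∃ T : Finset net.Weights, ↑T ⊆ net.params ∧
      (T.card : ℝ) ≤ Real.exp (8 * famNorm u ^ 2 * net.complexity / ε ^ 2) ∧
      ∀ A ∈ net.params, ∃ B ∈ T,
        famNorm (fun a => net.eval A (u a) - net.eval B (u a)) ≤ ε := by
  set Λ := Real.log (2 * (net.maxWidth : ℝ) ^ 2) with hΛ
  have hD' : (1 : ℝ) ≤ net.maxWidth := by exact_mod_cast hD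
  have hΛ0 : 0 ≤ Λ := Real.log_nonneg (by nlinarith)
  set β : Fin L → ℝ := fun k => net.b k / net.s k with hβ
  have hβ0 : ∀ k, 0 ≤ β k := fun k => div_nonneg (net.b_nonneg k) (net.s_pos k).le
  set W := ∑ k, β k ^ (2 / 3 : ℝ) with hW
  have hW0 : 0 ≤ W := Finset.sum_nonneg fun k _ => Real.rpow_nonneg (hβ0 k) _
  set G := net.lipBefore (Fin.last L) * famNorm u with hG
  have hG0 : 0 ≤ G := mul_nonneg (net.lipBefore_nonneg _) (famNorm_nonneg u)
  have hcplx : 8 * famNorm u ^ 2 * net.complexity = 8 * Λ * G ^ 2 * W ^ 3 := by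
    simp only [complexity, hG, lipBefore, before_last, ← mul_pow, Finset.prod_pow]
    simp only [mul_pow, ← hΛ, hW, hβ]
    ring
  -- With `β k = net.b k / net.s k`, the entropy is proportional to `∑ 1 / t k ^ 2` and the error to
  -- `∑ t k * β k`. The optimal radii are `τ * β k ^ (-1 / 3)`, making both sums multiples of `W`.
  -- For `β k = 0` the real power evaluates to `0`, which is the admissible degenerate radius.
  have hscaled : ∀ τ : ℝ, 0 < τ → ∃ T : Finset net.Weights, ↑T ⊆ net.params ∧
      (T.card : ℝ) ≤ Real.exp (2 * Λ * W / τ ^ 2) ∧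
      ∀ A ∈ net.params, ∃ B ∈ T,
        famNorm (fun a => net.eval A (u a) - net.eval B (u a)) ≤ 2 * G * (τ * W) := by
    intro τ hτ
    have ht0 : ∀ k, 0 ≤ τ * β k ^ (-(1 / 3) : ℝ) := fun k =>
      mul_nonneg hτ.le (Real.rpow_nonneg (hβ0 k) _)
    obtain ⟨T, hTp, hTc, hT⟩ := net.exists_layer_cover hD hne u
      (fun k => τ * β k ^ (-(1 / 3) : ℝ)) ht0 (fun k hk => by
        rcases (hβ0 k).eq_or_lt with h0 | h0
        · have := (div_eq_zero_iff.1 h0.symm).resolve_right (net.s_pos k).ne'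
          exact this
        · have := Real.rpow_pos_of_pos h0 (-(1 / 3))
          exact absurd hk (mul_pos hτ this).ne') (Fin.last L)
    rw [before_last] at hTc hT
    have e1 : ∑ k, 2 / (τ * β k ^ (-(1 / 3) : ℝ)) ^ 2 * Λ = 2 * Λ * W / τ ^ 2 := by
      rw [hW, Finset.mul_sum, Finset.sum_div]
      refine Finset.sum_congr rfl fun k _ => ?_
      have : β k ^ (2 / 3 : ℝ) = ((β k ^ (-(1 / 3) : ℝ)) ^ 2)⁻¹ := by
        rw [← Real.rpow_natCast, ← Real.rpow_mul (hβ0 k), ← Real.rpow_neg (hβ0 k)]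
        norm_num
      rw [this, mul_pow, div_eq_mul_inv, mul_inv]
      ring
    have e2 : ∑ k, τ * β k ^ (-(1 / 3) : ℝ) * (net.b k / net.s k) = τ * W := by
      rw [hW, Finset.mul_sum]
      refine Finset.sum_congr rfl fun k _ => ?_
      change τ * β k ^ (-(1 / 3) : ℝ) * β k = _
      rcases (hβ0 k).eq_or_lt with h0 | h0
      · rw [← h0, Real.zero_rpow (by norm_num : (2 / 3 : ℝ) ≠ 0)]; ring
      · rw [mul_assoc, ← Real.rpow_add_one h0.ne']
        norm_num
    rw [e1] at hTc
    rw [e2] at hT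
    exact ⟨T, hTp, hTc, hT⟩
  rw [hcplx]
  rcases (mul_nonneg hG0 hW0).eq_or_lt with h0 | h0
  -- Here `G * W = 0`, so the error is zero for every `τ`, but the required cardinality bound is
  -- `exp 0 = 1`. A large `τ` makes the exponent at most `1 / 4`, and an integer below `2` is at
  -- most `1`.
  · set τ := √(8 * Λ * W) + 1 with hτ
    have hτ0 : 0 < τ := by positivity
    obtain ⟨T, hTp, hTc, hT⟩ := hscaled τ hτ0
    refine ⟨T, hTp, ?_, fun A hA => ?_⟩
    · have h1 : 2 * Λ * W / τ ^ 2 ≤ 1 / 4 := by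
        rw [div_le_iff₀ (by positivity)]
        have h2 := Real.sq_sqrt (show 0 ≤ 8 * Λ * W by positivity)
        have h3 := Real.sqrt_nonneg (8 * Λ * W)
        rw [hτ]; nlinarith
      have h2 : Real.exp (1 / 4) < 2 := by
        rw [← Real.lt_log_iff_exp_lt (by norm_num)]
        linarith [Real.log_two_gt_d9]
      have h3 : (T.card : ℝ) < (2 : ℕ) := by
        push_cast
        exact (hTc.trans (Real.exp_le_exp.2 h1)).trans_lt h2
      have h4 : (T.card : ℝ) ≤ 1 := by
        have := Nat.cast_lt.1 h3
        exact_mod_cast Nat.lt_succ_iff.1 this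
      exact h4.trans (Real.one_le_exp (by positivity))
    · obtain ⟨B, hB, hd⟩ := hT A hA
      refine ⟨B, hB, hd.trans ?_⟩
      have : 2 * G * (τ * W) = 2 * τ * (G * W) := by ring
      rw [this, ← h0, mul_zero]
      exact hε.le
  · have hGp : 0 < G := by
      rcases hG0.eq_or_lt with h | h
      · rw [← h, zero_mul] at h0; exact absurd h0 (lt_irrefl _)
      · exact h
    have hWp : 0 < W := pos_of_mul_pos_right h0 hG0
    -- This `τ` makes the error exactly `ε`, and the exponent becomes `8 * Λ * G ^ 2 * W ^ 3 / ε ^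
    -- 2`.
    obtain ⟨T, hTp, hTc, hT⟩ := hscaled (ε / (2 * (G * W))) (by positivity)
    refine ⟨T, hTp, hTc.trans (le_of_eq ?_), fun A hA => ?_⟩
    · congr 1; field_simp; ring
    · obtain ⟨B, hB, hd⟩ := hT A hA
      refine ⟨B, hB, hd.trans (le_of_eq ?_)⟩
      field_simp

end NetSpec

/-! ### Lipschitz bounds for softmax and inner products. -/

section Softmax

variable {K : ℕ}

theorem norm_le_one_of_simplex {v : Vec K} (h0 : ∀ k, 0 ≤ v k) (h1 : ∑ k, v k = 1) : ‖v‖ ≤ 1 := by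
  refine (pow_le_pow_iff_left₀ (norm_nonneg _) zero_le_one two_ne_zero).1 ?_
  rw [EuclideanSpace.real_norm_sq_eq, one_pow, ← h1]
  refine Finset.sum_le_sum fun k _ => ?_
  have hk : v k ≤ 1 := h1 ▸ Finset.single_le_sum (fun k _ => h0 k) (Finset.mem_univ k)
  nlinarith [h0 k]

theorem sum_exp_pos (hK : 0 < K) (z : Vec K) : 0 < ∑ l, Real.exp (z l) :=
  Finset.sum_pos (fun _ _ => Real.exp_pos _) ⟨⟨0, hK⟩, Finset.mem_univ _⟩

theorem softmax_nonneg (z : Vec K) (k : Fin K) : 0 ≤ softmax z k :=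
  div_nonneg (Real.exp_pos _).le (Finset.sum_nonneg fun _ _ => (Real.exp_pos _).le)

theorem sum_softmax (hK : 0 < K) (z : Vec K) : ∑ k, softmax z k = 1 := by
  simp only [softmax, ← Finset.sum_div]
  exact div_self (sum_exp_pos hK z).ne'

theorem norm_softmax_le (hK : 0 < K) (z : Vec K) : ‖softmax z‖ ≤ 1 :=
  norm_le_one_of_simplex (softmax_nonneg z) (sum_softmax hK z)

/-- Numerator and denominator each change by a factor of at most `exp ‖z - z'‖`. -/
theorem softmax_le_exp_mul (hK : 0 < K) (z z' : Vec K) (k : Fin K) :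
    softmax z k ≤ Real.exp (2 * ‖z - z'‖) * softmax z' k := by
  have hcoord : ∀ l, z l ≤ ‖z - z'‖ + z' l ∧ z' l ≤ ‖z - z'‖ + z l := fun l => by
    have h := (abs_le.1 (PiLp.norm_apply_le (z - z') l))
    simp only [PiLp.sub_apply] at h
    exact ⟨by linarith [h.2], by linarith [h.1]⟩
  have h1 : Real.exp (z k) ≤ Real.exp ‖z - z'‖ * Real.exp (z' k) := by
    rw [← Real.exp_add]; exact Real.exp_le_exp.2 (hcoord k).1
  have h2 : ∑ l, Real.exp (z' l) ≤ Real.exp ‖z - z'‖ * ∑ l, Real.exp (z l) := by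
    rw [Finset.mul_sum]
    refine Finset.sum_le_sum fun l _ => ?_
    rw [← Real.exp_add]; exact Real.exp_le_exp.2 (hcoord l).2
  have hS := sum_exp_pos hK z
  have hS' := sum_exp_pos hK z'
  change Real.exp (z k) / _ ≤ _ * (Real.exp (z' k) / _)
  rw [div_le_iff₀ hS, two_mul, Real.exp_add]
  calc Real.exp (z k) ≤ Real.exp ‖z - z'‖ * Real.exp (z' k) := h1
    _ = Real.exp ‖z - z'‖ * (Real.exp (z' k) / ∑ l, Real.exp (z' l)) *
          ∑ l, Real.exp (z' l) := by field_simp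
    _ ≤ Real.exp ‖z - z'‖ * (Real.exp (z' k) / ∑ l, Real.exp (z' l)) *
          (Real.exp ‖z - z'‖ * ∑ l, Real.exp (z l)) := by gcongr
    _ = _ := by ring

/-- At distance at least `1 / 2` the trivial bound `2` suffices. Closer, the multiplicative
comparison gives a coordinatewise relative error `E - 1 ≤ 4 * ‖z - z'‖`. -/
theorem norm_softmax_sub_le (hK : 0 < K) (z z' : Vec K) :
    ‖softmax z - softmax z'‖ ≤ 4 * ‖z - z'‖ := by
  rcases le_total (1 / 2) ‖z - z'‖ with hx | hx
  · have := norm_sub_le (softmax z) (softmax z')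
    linarith [norm_softmax_le hK z, norm_softmax_le hK z']
  · set E := Real.exp (2 * ‖z - z'‖) with hE
    have hE1 : 1 ≤ E := Real.one_le_exp (by positivity)
    have hE2 : E - 1 ≤ 4 * ‖z - z'‖ := by
      have h := Real.abs_exp_sub_one_le (x := 2 * ‖z - z'‖) (by
        rw [abs_of_nonneg (by positivity)]; linarith)
      rw [abs_of_nonneg (by positivity : 0 ≤ 2 * ‖z - z'‖)] at h
      linarith [le_abs_self (E - 1)]
    have hk : ∀ k, |softmax z k - softmax z' k| ≤ (E - 1) * softmax z' k := fun k => by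
      have h1 := softmax_le_exp_mul hK z z' k
      have h2 := softmax_le_exp_mul hK z' z k
      rw [norm_sub_rev] at h2
      have h3 := softmax_nonneg z k
      have h4 := softmax_nonneg z' k
      rw [← hE] at h1 h2
      refine abs_sub_le_iff.2 ⟨by linarith, ?_⟩
      rcases le_total (softmax z' k) (softmax z k) with h | h <;> nlinarith
    have hn : ‖softmax z - softmax z'‖ ≤ (E - 1) * ‖softmax z'‖ := by
      refine (pow_le_pow_iff_left₀ (norm_nonneg _)
        (mul_nonneg (by linarith) (norm_nonneg _)) two_ne_zero).1 ?_
      rw [mul_pow, EuclideanSpace.real_norm_sq_eq, EuclideanSpace.real_norm_sq_eq,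
        Finset.mul_sum]
      refine Finset.sum_le_sum fun k _ => ?_
      rw [← mul_pow]
      exact sq_le_sq' (abs_le.1 (hk k)).1 (abs_le.1 (hk k)).2
    calc _ ≤ (E - 1) * ‖softmax z'‖ := hn
      _ ≤ (E - 1) * 1 := mul_le_mul_of_nonneg_left (norm_softmax_le hK z') (by linarith)
      _ ≤ _ := by linarith

theorem abs_inner_sub_inner_le {E : Type*} [NormedAddCommGroup E] [InnerProductSpace ℝ E]
    {a b a' b' : E} (hb : ‖b‖ ≤ 1) (ha' : ‖a'‖ ≤ 1) :
    |inner ℝ a b - inner ℝ a' b'| ≤ ‖a - a'‖ + ‖b - b'‖ := by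
  have h : inner ℝ a b - inner ℝ a' b' = inner ℝ (a - a') b + inner ℝ a' (b - b') := by
    rw [inner_sub_left, inner_sub_right]; ring
  rw [h]
  refine (abs_add_le _ _).trans (add_le_add ?_ ?_)
  · exact (abs_real_inner_le_norm _ _).trans (mul_le_of_le_one_right (norm_nonneg _) hb)
  · exact (abs_real_inner_le_norm _ _).trans (mul_le_of_le_one_left (norm_nonneg _) ha')

end Softmax

/-! ### Cross entropy: lower, upper and Lipschitz bounds. -/

section CrossEntropy

/-- Cross entropy of Bernoulli distributions with parameters `p` and `q`. -/
noncomputable def crossEntropy (p q : ℝ) : ℝ :=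
  p * Real.log (1 / q) + (1 - p) * Real.log (1 / (1 - q))

/-- This is `log s ≤ s - 1` at `s = √(b / a)`. Summed over the two outcomes it bounds the divergence
below by a squared Hellinger distance. -/
theorem two_mul_sub_sqrt_le {a b : ℝ} (ha : 0 ≤ a) (hb : 0 < b) :
    2 * (a - √(a * b)) ≤ a * Real.log (1 / b) - a * Real.log (1 / a) := by
  rcases ha.eq_or_lt with rfl | ha
  · simp
  · have h1 : Real.log (1 / b) - Real.log (1 / a) = -(2 * Real.log √(b / a)) := by
      rw [Real.log_sqrt (by positivity), Real.log_div hb.ne' ha.ne', one_div, one_div,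
        Real.log_inv, Real.log_inv]
      ring
    have h2 := Real.log_le_sub_one_of_pos (Real.sqrt_pos.2 (div_pos hb ha))
    have h3 : √(a * b) = a * √(b / a) := by
      rw [show a * b = a ^ 2 * (b / a) by field_simp, Real.sqrt_mul (by positivity),
        Real.sqrt_sq ha.le]
    rw [← mul_sub, h1, h3]
    nlinarith

/-- A form of Pinsker's inequality. -/
theorem sq_sub_le_crossEntropy_sub {p q : ℝ} (hp0 : 0 ≤ p) (hp1 : p ≤ 1) (hq0 : 0 < q)
    (hq1 : q < 1) : (p - q) ^ 2 ≤ crossEntropy p q - crossEntropy p p := by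
  have h1 := two_mul_sub_sqrt_le hp0 hq0
  have h2 := two_mul_sub_sqrt_le (sub_nonneg.2 hp1) (sub_pos.2 hq1)
  have s1 := Real.sq_sqrt (mul_nonneg hp0 hq0.le)
  have s2 := Real.sq_sqrt (mul_nonneg (sub_nonneg.2 hp1) (sub_pos.2 hq1).le)
  -- With `B = √(p * q) + √((1 - p) * (1 - q))`, this is equivalent to `B ^ 2 ≤ 1 - (p - q) ^ 2`.
  -- The divergence is at least `2 * (1 - B)`, which is at least `1 - B ^ 2`.
  have h3 : 2 * (√(p * q) * √((1 - p) * (1 - q))) ≤ p * (1 - p) + q * (1 - q) := by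
    have e1 : √(p * q) * √((1 - p) * (1 - q)) = √(p * (1 - p)) * √(q * (1 - q)) := by
      rw [← Real.sqrt_mul (by positivity), ← Real.sqrt_mul
        (mul_nonneg hp0 (sub_nonneg.2 hp1))]
      congr 1; ring
    have s3 := Real.sq_sqrt (mul_nonneg hp0 (sub_nonneg.2 hp1))
    have s4 := Real.sq_sqrt (mul_nonneg hq0.le (sub_pos.2 hq1).le)
    rw [e1]
    nlinarith [sq_nonneg (√(p * (1 - p)) - √(q * (1 - q)))]
  simp only [crossEntropy]
  nlinarith [sq_nonneg (1 - (√(p * q) + √((1 - p) * (1 - q))))]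

theorem mul_log_sub_le {a b : ℝ} (ha : 0 ≤ a) (hb : 0 < b) :
    a * Real.log (1 / b) - a * Real.log (1 / a) ≤ a * (a / b - 1) := by
  rcases ha.eq_or_lt with rfl | ha
  · simp
  · have h1 : Real.log (1 / b) - Real.log (1 / a) = Real.log (a / b) := by
      rw [Real.log_div ha.ne' hb.ne', one_div, one_div, Real.log_inv, Real.log_inv]
      ring
    rw [← mul_sub, h1]
    exact mul_le_mul_of_nonneg_left (Real.log_le_sub_one_of_pos (div_pos ha hb)) ha.le

/-- The divergence is at most the chi-square distance, by `log s ≤ s - 1` at the likelihood ratios.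
-/
theorem crossEntropy_sub_le {p q : ℝ} (hp0 : 0 ≤ p) (hp1 : p ≤ 1) (hq0 : 0 < q)
    (hq1 : q < 1) : crossEntropy p q - crossEntropy p p ≤ (p - q) ^ 2 / (q * (1 - q)) := by
  have h1 := mul_log_sub_le hp0 hq0
  have h2 := mul_log_sub_le (sub_nonneg.2 hp1) (sub_pos.2 hq1)
  have hq1' := sub_pos.2 hq1
  have h3 : (p - q) ^ 2 / (q * (1 - q))
      = p * (p / q - 1) + (1 - p) * ((1 - p) / (1 - q) - 1) := by
    field_simp
    ring
  rw [h3]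
  simp only [crossEntropy]
  linarith

theorem abs_log_sub_log_le {α a b : ℝ} (hα : 0 < α) (ha : α < a) (hb : α < b) :
    |Real.log (1 / a) - Real.log (1 / b)| ≤ |a - b| / α := by
  have key : ∀ a b : ℝ, α < a → α < b → Real.log a - Real.log b ≤ |a - b| / α := by
    intro a b ha hb
    have ha0 := hα.trans ha
    have hb0 := hα.trans hb
    rw [← Real.log_div ha0.ne' hb0.ne']
    calc _ ≤ a / b - 1 := Real.log_le_sub_one_of_pos (div_pos ha0 hb0)
      _ = (a - b) / b := by field_simp
      _ ≤ |a - b| / b := by gcongr; exact le_abs_self _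
      _ ≤ |a - b| / α := by gcongr
  rw [one_div, one_div, Real.log_inv, Real.log_inv]
  refine abs_sub_le_iff.2 ⟨?_, ?_⟩
  · have := key b a hb ha
    rw [abs_sub_comm] at this
    linarith
  · have := key a b ha hb
    linarith

theorem log_one_div_mem {α q : ℝ} (hα : 0 < α) (h : α < q) (h1 : q ≤ 1) :
    0 ≤ Real.log (1 / q) ∧ Real.log (1 / q) ≤ Real.log (1 / α) := by
  have hq := hα.trans h
  refine ⟨Real.log_nonneg ?_, Real.log_le_log (by positivity) (by gcongr)⟩
  rwa [le_div_iff₀ hq, one_mul]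

theorem crossEntropy_label (y : Fin 2) (q : ℝ) : crossEntropy ((y : ℕ) : ℝ) q =
    if y = 1 then Real.log (1 / q) else Real.log (1 / (1 - q)) := by
  fin_cases y <;> simp [crossEntropy]

theorem crossEntropy_label_mem {α q : ℝ} (hα : 0 < α) (h0 : α < q) (h1 : q < 1 - α) (y : Fin 2) :
    0 ≤ crossEntropy ((y : ℕ) : ℝ) q ∧ crossEntropy ((y : ℕ) : ℝ) q ≤ Real.log (1 / α) := by
  rw [crossEntropy_label]
  split_ifs
  · exact log_one_div_mem hα h0 (by linarith)
  · exact log_one_div_mem hα (by linarith) (by linarith)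

theorem abs_crossEntropy_label_sub_le {α q r : ℝ} (hα : 0 < α) (hq0 : α < q) (hq1 : q < 1 - α)
    (hr0 : α < r) (hr1 : r < 1 - α) (y : Fin 2) :
    |crossEntropy ((y : ℕ) : ℝ) q - crossEntropy ((y : ℕ) : ℝ) r| ≤ |q - r| / α := by
  rw [crossEntropy_label, crossEntropy_label]
  split_ifs
  · exact abs_log_sub_log_le hα hq0 hr0
  · have := abs_log_sub_log_le (a := 1 - q) (b := 1 - r) hα (by linarith) (by linarith)
    rwa [show 1 - q - (1 - r) = -(q - r) by ring, abs_neg] at this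

end CrossEntropy

/-! ### The law of the annotations and transfer to the probability space. -/

section SampleLaw

/-- The law of a single annotation `(i, j, y)`. -/
noncomputable def annotationLaw {N : ℕ} (P : Matrix (Fin N) (Fin N) ℝ)
    (z : Fin N × Fin N × Fin 2) : ℝ :=
  1 / (N : ℝ) ^ 2 * if z.2.2 = 1 then P z.1 z.2.1 else 1 - P z.1 z.2.1

variable {N : ℕ} {P : Matrix (Fin N) (Fin N) ℝ}

theorem annotationLaw_nonneg (hP0 : ∀ a b, 0 ≤ P a b) (hP1 : ∀ a b, P a b ≤ 1)
    (z : Fin N × Fin N × Fin 2) : 0 ≤ annotationLaw P z := by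
  refine mul_nonneg (by positivity) ?_
  split_ifs
  · exact hP0 _ _
  · exact sub_nonneg.2 (hP1 _ _)

theorem mean_annotationLaw (G : Fin N × Fin N × Fin 2 → ℝ) :
    mean (annotationLaw P) G = 1 / (N : ℝ) ^ 2 *
      ∑ a, ∑ b, (P a b * G (a, b, 1) + (1 - P a b) * G (a, b, 0)) := by
  simp only [mean, Fintype.sum_prod_type, Finset.mul_sum, Fin.sum_univ_two, annotationLaw]
  refine Finset.sum_congr rfl fun a _ => Finset.sum_congr rfl fun b _ => ?_
  simp; ring

/-- Cross entropy is affine in its first argument, so averaging over the label replaces it by its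
mean `P a b`. -/
theorem mean_annotationLaw_crossEntropy (Q : Matrix (Fin N) (Fin N) ℝ) :
    mean (annotationLaw P) (fun z => crossEntropy ((z.2.2 : ℕ) : ℝ) (Q z.1 z.2.1)) =
      1 / (N : ℝ) ^ 2 * ∑ a, ∑ b, crossEntropy (P a b) (Q a b) := by
  rw [mean_annotationLaw]
  simp [crossEntropy]

theorem sum_annotationLaw (hN : 0 < N) : ∑ z, annotationLaw P z = 1 := by
  have h := mean_annotationLaw (P := P) fun _ => 1
  have hN' : (N : ℝ) ≠ 0 := by positivity
  simp only [mean, mul_one] at h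
  rw [h]
  simp
  field_simp

variable {Ω : Type*} [MeasurableSpace Ω] {μ : Measure Ω} {M : ℕ}
  {i j : Fin M → Ω → Fin N} {y : Fin M → Ω → Fin 2}

namespace IsAnnotationSample

theorem measurable_annotation (hS : IsAnnotationSample μ P i j y) (m : Fin M) :
    Measurable fun ω => (i m ω, j m ω, y m ω) :=
  (hS.measurable_fst m).prodMk ((hS.measurable_snd m).prodMk (hS.measurable_label m))

theorem measureReal_annotation_eq [IsFiniteMeasure μ] (hS : IsAnnotationSample μ P i j y) (m : Fin M)
    (z : Fin N × Fin N × Fin 2) :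
    μ.real {ω | (i m ω, j m ω, y m ω) = z} = annotationLaw P z := by
  obtain ⟨a, b, c⟩ := z
  have hN : (N : ℝ) ≠ 0 := by
    have := a.pos
    positivity
  set E : Set Ω := {ω | i m ω = a ∧ j m ω = b} with hE
  have hEm : MeasurableSet E :=
    (hS.measurable_fst m (measurableSet_singleton a)).inter
      (hS.measurable_snd m (measurableSet_singleton b))
  have hEu : μ.real E = 1 / (N : ℝ) ^ 2 := hS.uniform m a b
  have h1 : μ.real (E ∩ {ω | y m ω = 1}) = 1 / (N : ℝ) ^ 2 * P a b := by
    have h := hS.bernoulli m a b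
    rw [measureReal_def, cond_apply hEm, ENNReal.toReal_mul, ENNReal.toReal_inv,
      ← measureReal_def, ← measureReal_def, hEu] at h
    rw [← h]
    field_simp
  have hset : ∀ c : Fin 2, {ω | (i m ω, j m ω, y m ω) = (a, b, c)} = E ∩ {ω | y m ω = c} :=
    fun c => by ext ω; simp [hE, and_assoc]
  rw [hset]
  have hc : c = 0 ∨ c = 1 := by omega
  rcases hc with rfl | rfl
  · have h0 : E ∩ {ω | y m ω = 0} = E \ {ω | y m ω = 1} := by
      ext ω
      simp only [Set.mem_inter_iff, Set.mem_sdiff, Set.mem_ofPred_eq]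
      refine and_congr_right fun _ => ?_
      omega
    have h2 := measureReal_sdiff_add_inter (μ := μ) (s := E)
      (hS.measurable_label m (measurableSet_singleton 1))
    have h3 : μ.real (E \ {ω | y m ω = 1}) + μ.real (E ∩ {ω | y m ω = 1}) = μ.real E := h2
    rw [h0]
    simp only [annotationLaw]
    rw [if_neg (by decide)]
    linarith
  · rw [h1]
    simp [annotationLaw]

theorem measureReal_sample_eq [IsFiniteMeasure μ] (hS : IsAnnotationSample μ P i j y)
    (z : Fin M → Fin N × Fin N × Fin 2) :
    μ.real {ω | (fun m => (i m ω, j m ω, y m ω)) = z} = ∏ m, annotationLaw P (z m) := by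
  have h := hS.indep.measure_inter_preimage_eq_mul Finset.univ (sets := fun m => {z m})
    fun m _ => measurableSet_singleton _
  have hset : {ω | (fun m => (i m ω, j m ω, y m ω)) = z}
      = ⋂ m ∈ Finset.univ, (fun ω => (i m ω, j m ω, y m ω)) ⁻¹' {z m} := by
    ext ω; simp [funext_iff]
  rw [hset, measureReal_def, h, ENNReal.toReal_prod]
  exact Finset.prod_congr rfl fun m _ => hS.measureReal_annotation_eq m (z m)

/-- Events in the finite sample space, transferred to the underlying probability space. -/
theorem one_sub_le_measureReal [IsProbabilityMeasure μ] (hS : IsAnnotationSample μ P i j y)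
    (B : Finset (Fin M → Fin N × Fin N × Fin 2)) {A : Set Ω}
    (hA : ∀ ω, (fun m => (i m ω, j m ω, y m ω)) ∉ B → ω ∈ A) :
    1 - ∑ z ∈ B, ∏ m, annotationLaw P (z m) ≤ μ.real A := by
  set ζ : Ω → Fin M → Fin N × Fin N × Fin 2 := fun ω m => (i m ω, j m ω, y m ω) with hζ
  have hζm : Measurable ζ := measurable_pi_lambda _ fun m => hS.measurable_annotation m
  have hBm : MeasurableSet (ζ ⁻¹' B) := hζm B.finite_toSet.measurableSet
  have h1 : μ.real (ζ ⁻¹' B) ≤ ∑ z ∈ B, ∏ m, annotationLaw P (z m) := by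
    have hU : ζ ⁻¹' B = ⋃ z ∈ B, {ω | ζ ω = z} := by ext ω; simp
    rw [hU]
    refine (measureReal_biUnion_finset_le _ _).trans (le_of_eq ?_)
    exact Finset.sum_congr rfl fun z _ => hS.measureReal_sample_eq z
  have h2 : μ.real (ζ ⁻¹' B)ᶜ ≤ μ.real A := measureReal_mono fun ω hω => hA ω hω
  rw [probReal_compl_eq_one_sub hBm] at h2
  linarith

end IsAnnotationSample

end SampleLaw

/-! ### Rademacher complexity of the network loss and the final constants. -/

section Network

variable {L : ℕ} (net : NetSpec L) {N M : ℕ} (x : Fin N → Vec net.inDim)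

/-- The loss of the network with weights `θ` on a single annotation. -/
noncomputable def netLoss (θ : net.params) (z : Fin N × Fin N × Fin 2) : ℝ :=
  crossEntropy ((z.2.2 : ℕ) : ℝ) (gram (net.fn θ) x z.1 z.2.1)

/-- The sampled inputs, in the order of the columns of `sampleMatrix`. -/
def sampleFam {d : ℕ} (x : Fin N → Vec d) (z : Fin M → Fin N × Fin N × Fin 2)
    (c : Fin M × Fin 2) : Vec d :=
  x (if c.2 = 0 then (z c.1).1 else (z c.1).2.1)

theorem famNorm_sampleFam {d : ℕ} (x : Fin N → Vec d) (z : Fin M → Fin N × Fin N × Fin 2) :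
    famNorm (sampleFam x z) =
      frobNorm (sampleMatrix x (fun m => (z m).1) fun m => (z m).2.1) := by
  rw [frobNorm, ← Real.sqrt_sq (famNorm_nonneg _), famNorm_sq]
  congr 1
  simp only [EuclideanSpace.real_norm_sq_eq]
  rw [Finset.sum_comm]
  rfl

/-- Softmax contributes the Lipschitz factor `4`, the logarithm `1 / α`, and `(4 * da + 4 * db) ^ 2
≤ 32 * (da ^ 2 + db ^ 2)`. -/
theorem sum_sq_netLoss_sub_le (hK : 0 < net.outDim) {α : ℝ} (hα : 0 < α)
    (hinner : ∀ θ ∈ net.params, ∀ a b, α < gram (net.fn θ) x a b ∧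
      gram (net.fn θ) x a b < 1 - α) (θ θ' : net.params) (z : Fin M → Fin N × Fin N × Fin 2) :
    ∑ m, (netLoss net x θ (z m) - netLoss net x θ' (z m)) ^ 2 ≤ 32 / α ^ 2 *
      famNorm (fun c => net.eval θ (sampleFam x z c) - net.eval θ' (sampleFam x z c)) ^ 2 := by
  rw [famNorm_sq, Fintype.sum_prod_type, Finset.mul_sum]
  refine Finset.sum_le_sum fun m _ => ?_
  rw [Fin.sum_univ_two]
  have hi : sampleFam x z (m, 0) = x (z m).1 := by simp [sampleFam]
  have hj : sampleFam x z (m, 1) = x (z m).2.1 := by simp [sampleFam]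
  rw [hi, hj]
  set da := ‖net.eval θ (x (z m).1) - net.eval θ' (x (z m).1)‖ with hda
  set db := ‖net.eval θ (x (z m).2.1) - net.eval θ' (x (z m).2.1)‖ with hdb
  have h1 := hinner θ θ.2 (z m).1 (z m).2.1
  have h2 := hinner θ' θ'.2 (z m).1 (z m).2.1
  have h3 : |gram (net.fn θ) x (z m).1 (z m).2.1 - gram (net.fn θ') x (z m).1 (z m).2.1|
      ≤ 4 * da + 4 * db :=
    (abs_inner_sub_inner_le (norm_softmax_le hK _) (norm_softmax_le hK _)).trans
      (add_le_add (norm_softmax_sub_le hK _ _) (norm_softmax_sub_le hK _ _))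
  have h4 := abs_crossEntropy_label_sub_le hα h1.1 h1.2 h2.1 h2.2 (z m).2.2
  have h5 : |netLoss net x θ (z m) - netLoss net x θ' (z m)| ≤ (4 * da + 4 * db) / α :=
    h4.trans (by gcongr)
  have h6 := sq_le_sq' (by linarith [(abs_le.1 h5).1]) (abs_le.1 h5).2
  refine h6.trans ?_
  rw [div_pow, div_mul_eq_mul_div]
  gcongr
  nlinarith [sq_nonneg (da - db)]

theorem empRad_netLoss_le (hD : 1 ≤ net.maxWidth) (hne : net.params.Nonempty)
    (hK : 0 < net.outDim) {α : ℝ} (hα : 0 < α) (hα1 : α < 1)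
    (hinner : ∀ θ ∈ net.params, ∀ a b, α < gram (net.fn θ) x a b ∧
      gram (net.fn θ) x a b < 1 - α) (hM : 0 < M) (z : Fin M → Fin N × Fin N × Fin 2) :
    empRad (netLoss net x) z ≤ 2 * Real.log (1 / α) +
      Nat.log 2 M * (2 * √2 * (16 / α * famNorm (sampleFam x z) * √net.complexity)) := by
  have : Nonempty net.params := hne.to_subtype
  have hlog : 0 < Real.log (1 / α) := Real.log_pos ((one_lt_div hα).2 hα1)
  have hmem := fun (θ : net.params) (a : Fin N × Fin N × Fin 2) =>
    crossEntropy_label_mem hα (hinner θ θ.2 a.1 a.2.1).1 (hinner θ θ.2 a.1 a.2.1).2 a.2.2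
  have hD' : (1 : ℝ) ≤ net.maxWidth := by exact_mod_cast hD
  have hR : 0 ≤ net.complexity := by
    refine mul_nonneg (mul_nonneg (Real.log_nonneg (by nlinarith))
      (Finset.prod_nonneg fun l _ => by positivity)) (pow_nonneg (Finset.sum_nonneg fun l _ =>
        Real.rpow_nonneg (div_nonneg (net.b_nonneg l) (net.s_pos l).le) _) 3)
  have hF := famNorm_nonneg (sampleFam x z)
  refine empRad_le_of_cover (fun θ a => (hmem θ a).1) (fun θ a => (hmem θ a).2) hlog hM z
    (by positivity) fun ε hε => ?_
  -- At this radius the losses are `ε`-close. The exponent gains `32 / α ^ 2`, and `8 * 32 = 16 ^ 2`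
  -- explains the `16 / α` in the bound.
  obtain ⟨T, hTp, hTc, hT⟩ := net.exists_eval_cover hD hne (sampleFam x z)
    (ε := ε * α / √32) (by positivity)
  classical
  refine ⟨T.subtype (· ∈ net.params), ?_, fun θ => ?_⟩
  · have h1 : (T.subtype (· ∈ net.params)).card ≤ T.card := by
      rw [Finset.card_subtype]; exact Finset.card_filter_le _ _
    refine (Nat.cast_le.2 h1).trans (hTc.trans (le_of_eq ?_))
    congr 1
    rw [mul_pow, mul_pow, div_pow, div_pow, mul_pow, Real.sq_sqrt hR,
      Real.sq_sqrt (by norm_num : (0 : ℝ) ≤ 32)]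
    field_simp
    ring
  · obtain ⟨B, hB, hd⟩ := hT θ θ.2
    refine ⟨⟨B, hTp hB⟩, by simpa using hB, ?_⟩
    refine (sum_sq_netLoss_sub_le net x hK hα hinner θ ⟨B, hTp hB⟩ z).trans ?_
    have h1 := pow_le_pow_left₀ (famNorm_nonneg _) hd 2
    rw [div_pow, mul_pow, Real.sq_sqrt (by norm_num : (0 : ℝ) ≤ 32)] at h1
    calc _ ≤ 32 / α ^ 2 * (ε ^ 2 * α ^ 2 / 32) := by gcongr
      _ = ε ^ 2 := by field_simp

theorem natLog_le_log_div (M : ℕ) : (Nat.log 2 M : ℝ) ≤ Real.log M / Real.log 2 := by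
  have := Real.natLog_le_logb M 2
  simpa [Real.logb] using this

/-- Comparison of the deviation bound with the stated error bound. -/
theorem deviation_add_approx_le_errorSq {α ν δ SF R ρ t : ℝ} (hα : 0 < α) (hα1 : α < 1)
    (hν : 0 < ν) (hδ : 0 < δ) (hδ1 : δ < 1) (hM : 0 < M) (hSF : 0 ≤ SF)
    (hρ : ρ ≤ 2 * Real.log (1 / α) + Nat.log 2 M * (2 * √2 * (16 / α * SF * √R)))
    (ht : t = Real.log (1 / α) * √(32 * M * Real.log (1 / δ))) :
    (2 * ρ + t) / M + 8 * ν / α ≤ errorSq α ν δ M SF R := by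
  have hM' : (0 : ℝ) < M := by exact_mod_cast hM
  have hlog : 0 < Real.log (1 / α) := Real.log_pos ((one_lt_div hα).2 hα1)
  have hlog2 : 0 < Real.log 2 := Real.log_pos (by norm_num)
  have hlogM : 0 ≤ Real.log M := Real.log_natCast_nonneg M
  have hQ : 0 ≤ √2 * (SF * √R) / α := by positivity
  have h1 : Nat.log 2 M * (2 * √2 * (16 / α * SF * √R))
      ≤ 32 * (Real.log M / Real.log 2) * (√2 * (SF * √R) / α) := by
    calc _ = 32 * (Nat.log 2 M : ℝ) * (√2 * (SF * √R) / α) := by ring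
      _ ≤ _ := by
        have := natLog_le_log_div M
        gcongr
  have h2 : t / M ≤ 64 * Real.log (1 / α) * √(2 * Real.log (4 / δ) / M) := by
    have e1 : √(32 * M * Real.log (1 / δ)) ≤ M * (64 * √(2 * Real.log (4 / δ) / M)) := by
      refine Real.sqrt_le_iff.2 ⟨by positivity, ?_⟩
      have hl : Real.log (1 / δ) ≤ Real.log (4 / δ) :=
        Real.log_le_log (by positivity) (by gcongr; norm_num)
      have hl0 : 0 ≤ Real.log (1 / δ) := Real.log_nonneg ((one_le_div hδ).2 hδ1.le)
      have hl4 := hl0.trans hl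
      rw [mul_pow, mul_pow, Real.sq_sqrt (by positivity)]
      have : (M : ℝ) ^ 2 * (64 ^ 2 * (2 * Real.log (4 / δ) / M))
          = M * (8192 * Real.log (4 / δ)) := by field_simp; ring
      rw [this]
      nlinarith
    rw [ht, div_le_iff₀ hM']
    calc _ ≤ Real.log (1 / α) * (M * (64 * √(2 * Real.log (4 / δ) / M))) := by gcongr
      _ = _ := by ring
  have h3 : 8 * ν / α ≤ 16 * ν / α := by gcongr; norm_num
  have h4 : 2 * ρ / M ≤ 64 * Real.log (1 / α) / M +
      96 * √2 * Real.log M / (α * M * Real.log 2) * SF * √R := by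
    have e1 : 96 * √2 * Real.log M / (α * M * Real.log 2) * SF * √R
        = (96 * (Real.log M / Real.log 2) * (√2 * (SF * √R) / α)) / M := by
      field_simp
    rw [e1, ← add_div]
    gcongr
    have : 0 ≤ (Real.log M / Real.log 2) * (√2 * (SF * √R) / α) := by positivity
    linarith
  rw [errorSq, add_div]
  linarith

end Network

/-! ### Excess risk against Frobenius distance. -/

section GramBounds

theorem gram_mem_of_simplex {d K N : ℕ} {f : Vec d → Vec K} {x : Fin N → Vec d}
    (hf : ∀ n, (∀ k, 0 ≤ f (x n) k) ∧ ∑ k, f (x n) k = 1) (a b : Fin N) :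
    0 ≤ gram f x a b ∧ gram f x a b ≤ 1 := by
  constructor
  · change 0 ≤ inner ℝ (f (x a)) (f (x b))
    rw [PiLp.inner_apply]
    exact Finset.sum_nonneg fun k _ => mul_nonneg ((hf b).1 k) ((hf a).1 k)
  · exact (real_inner_le_norm _ _).trans (mul_le_one₀ (norm_le_one_of_simplex (hf a).1 (hf a).2)
      (norm_nonneg (f (x b))) (norm_le_one_of_simplex (hf b).1 (hf b).2))

theorem frobNorm_sq {m n : Type*} [Fintype m] [Fintype n] (A : Matrix m n ℝ) :
    frobNorm A ^ 2 = ∑ i, ∑ j, A i j ^ 2 :=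
  Real.sq_sqrt (Finset.sum_nonneg fun _ _ => Finset.sum_nonneg fun _ _ => sq_nonneg _)

/-- The squared distance of the Gram matrices is at most the excess risk. -/
theorem frobNorm_sub_sq_le_excess {N : ℕ} {P Q : Matrix (Fin N) (Fin N) ℝ}
    (hP : ∀ a b, 0 ≤ P a b ∧ P a b ≤ 1) (hQ : ∀ a b, 0 < Q a b ∧ Q a b < 1) :
    1 / (N : ℝ) ^ 2 * frobNorm (Q - P) ^ 2 ≤
      1 / (N : ℝ) ^ 2 * ∑ a, ∑ b, crossEntropy (P a b) (Q a b) -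
        1 / (N : ℝ) ^ 2 * ∑ a, ∑ b, crossEntropy (P a b) (P a b) := by
  rw [← mul_sub, frobNorm_sq]
  simp only [← Finset.sum_sub_distrib]
  refine mul_le_mul_of_nonneg_left (Finset.sum_le_sum fun a _ => Finset.sum_le_sum fun b _ => ?_)
    (by positivity)
  have h := sq_sub_le_crossEntropy_sub (hP a b).1 (hP a b).2 (hQ a b).1 (hQ a b).2
  rw [Matrix.sub_apply, ← neg_sub, neg_sq]
  exact h

/-- The excess risk of a uniform approximation of the ground truth. -/
theorem excess_le_of_approx {N : ℕ} (hN : 0 < N) {P Q : Matrix (Fin N) (Fin N) ℝ} {α ν : ℝ}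
    (hα : 0 < α) (hν0 : 0 < ν) (hν1 : ν < 1) (hP : ∀ a b, 0 ≤ P a b ∧ P a b ≤ 1)
    (hQ : ∀ a b, α < Q a b ∧ Q a b < 1 - α) (hPQ : ∀ a b, |P a b - Q a b| ≤ 2 * ν) :
    1 / (N : ℝ) ^ 2 * ∑ a, ∑ b, crossEntropy (P a b) (Q a b) -
      1 / (N : ℝ) ^ 2 * ∑ a, ∑ b, crossEntropy (P a b) (P a b) ≤ 8 * ν / α := by
  have hN' : (N : ℝ) ≠ 0 := by positivity
  have hterm : ∀ a b, crossEntropy (P a b) (Q a b) - crossEntropy (P a b) (P a b)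
      ≤ 8 * ν / α := fun a b => by
    obtain ⟨h1, h2⟩ := hQ a b
    have hq0 : 0 < Q a b := hα.trans h1
    have hq1 : Q a b < 1 := by linarith
    refine (crossEntropy_sub_le (hP a b).1 (hP a b).2 hq0 hq1).trans ?_
    have h3 : (P a b - Q a b) ^ 2 ≤ 4 * ν := by
      have h4 := abs_le.1 (hPQ a b)
      have := sq_le_sq' h4.1 h4.2
      nlinarith
    -- One of `Q a b` and `1 - Q a b` is at least `1 / 2`, and the other exceeds `α`.
    have h5 : α / 2 ≤ Q a b * (1 - Q a b) := by
      rcases le_total (Q a b) (1 / 2) with h | h <;> nlinarith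
    calc _ ≤ 4 * ν / (α / 2) := by gcongr
      _ = 8 * ν / α := by field_simp; norm_num
  rw [← mul_sub]
  simp only [← Finset.sum_sub_distrib]
  calc _ ≤ 1 / (N : ℝ) ^ 2 * ∑ _a : Fin N, ∑ _b : Fin N, 8 * ν / α := by
        refine mul_le_mul_of_nonneg_left ?_ (by positivity)
        exact Finset.sum_le_sum fun a _ => Finset.sum_le_sum fun b _ => hterm a b
    _ = 8 * ν / α := by simp; field_simp

end GramBounds

end PairwiseClustering

open PairwiseClustering in
theorem lemma1 {Ω : Type*} [MeasurableSpace Ω] (μ : MeasureTheory.Measure Ω)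
    [MeasureTheory.IsProbabilityMeasure μ]
    {L : ℕ} (net : PairwiseClustering.NetSpec L)
    -- the data space, the data points and the ground-truth membership map
    (X : Set (PairwiseClustering.Vec net.inDim))
    {N : ℕ} (x : Fin N → PairwiseClustering.Vec net.inDim) (hx : ∀ n, x n ∈ X)
    (fTrue : PairwiseClustering.Vec net.inDim → PairwiseClustering.Vec net.outDim)
    (hfTrue : ∀ u ∈ X, (∀ k, 0 ≤ fTrue u k) ∧ ∑ k, fTrue u k = 1)
    -- the assumption on the function class
    (ν : ℝ) (hν0 : 0 < ν) (hν1 : ν < 1)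
    (happrox : ∃ f ∈ net.functionClass, ∀ u ∈ X, ‖f u - fTrue u‖ ≤ ν)
    (α : ℝ) (hα0 : 0 < α) (hα1 : α < 1)
    (hinner : ∀ f ∈ net.functionClass, ∀ u ∈ X, ∀ v ∈ X,
      α < inner ℝ (f u) (f v) ∧ inner ℝ (f u) (f v) < 1 - α)
    -- the annotations
    {M : ℕ} (hM : 0 < M)
    (i j : Fin M → Ω → Fin N) (y : Fin M → Ω → Fin 2)
    (hS : PairwiseClustering.IsAnnotationSample μ (PairwiseClustering.gram fTrue x) i j y)
    (δ : ℝ) (hδ0 : 0 < δ) (hδ1 : δ < 1) :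
    1 - δ ≤ μ.real {ω |
      ∀ θ ∈ net.params,
        IsMinOn (fun θ' => PairwiseClustering.logisticLoss x
          (fun m => i m ω) (fun m => j m ω) (fun m => y m ω) (net.fn θ')) net.params θ →
        1 / (N : ℝ) ^ 2 * PairwiseClustering.frobNorm
            (PairwiseClustering.gram (net.fn θ) x - PairwiseClustering.gram fTrue x) ^ 2
          ≤ PairwiseClustering.errorSq α ν δ M
              (PairwiseClustering.frobNorm (PairwiseClustering.sampleMatrix x
                (fun m => i m ω) (fun m => j m ω)))
              net.complexity} := by
  classical
  have hM' : (0 : ℝ) < M := by exact_mod_cast hM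
  obtain ⟨ω₀⟩ : Nonempty Ω := nonempty_of_isProbabilityMeasure μ
  have hN : 0 < N := (i ⟨0, hM⟩ ω₀).pos
  obtain ⟨_, ⟨A₀, hA₀, rfl⟩, happ⟩ := happrox
  have hQ : ∀ θ ∈ net.params, ∀ a b, α < gram (net.fn θ) x a b ∧
      gram (net.fn θ) x a b < 1 - α := fun θ hθ a b =>
    hinner _ ⟨θ, hθ, rfl⟩ _ (hx a) _ (hx b)
  -- With no output coordinates all inner products would vanish, contradicting the lower bound `α`.
  have hK : 0 < net.outDim := by
    by_contra hK
    have hK0 : net.outDim = 0 := by omega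
    have : IsEmpty (Fin net.outDim) := by rw [hK0]; infer_instance
    have h := (hQ A₀ hA₀ ⟨0, hN⟩ ⟨0, hN⟩).1
    simp [gram, PiLp.inner_apply] at h
    linarith
  have hD : 1 ≤ net.maxWidth := hK.trans_le (net.width_le _)
  set P := gram fTrue x with hPdef
  have hP : ∀ a b, 0 ≤ P a b ∧ P a b ≤ 1 := gram_mem_of_simplex fun n => hfTrue _ (hx n)
  have hPQ : ∀ a b, |P a b - gram (net.fn A₀) x a b| ≤ 2 * ν := fun a b => by
    have h := abs_inner_sub_inner_le (a := fTrue (x a)) (b := fTrue (x b))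
      (a' := net.fn A₀ (x a)) (b' := net.fn A₀ (x b))
      (norm_le_one_of_simplex (hfTrue _ (hx b)).1 (hfTrue _ (hx b)).2) (norm_softmax_le hK _)
    rw [norm_sub_rev, norm_sub_rev (fTrue (x b))] at h
    have h1 := happ _ (hx a)
    have h2 := happ _ (hx b)
    refine h.trans (by linarith)
  set c := Real.log (1 / α) with hc
  have hcpos : 0 < c := Real.log_pos ((one_lt_div hα0).2 hα1)
  have hmem := fun (θ : net.params) (a : Fin N × Fin N × Fin 2) =>
    crossEntropy_label_mem hα0 (hQ θ θ.2 a.1 a.2.1).1 (hQ θ θ.2 a.1 a.2.1).2 a.2.2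
  -- Chosen so that the McDiarmid tail with differences `4 * c` equals `δ`.
  set t := c * √(32 * M * Real.log (1 / δ)) with ht
  have hlogδ : 0 ≤ Real.log (1 / δ) := Real.log_nonneg ((one_le_div hδ0).2 hδ1.le)
  have hdev := sum_weights_deviation_le (n := M) (p := annotationLaw P) (g := netLoss net x)
    (annotationLaw_nonneg (fun a b => (hP a b).1) fun a b => (hP a b).2)
    (sum_annotationLaw hN) (fun θ a => (hmem θ a).1) (fun θ a => (hmem θ a).2) hcpos hM
    ⟨A₀, hA₀⟩ (t := t) (by positivity)
  have hexp : Real.exp (-(t ^ 2 / (2 * (M * (4 * c) ^ 2)))) = δ := by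
    rw [ht, mul_pow, Real.sq_sqrt (by positivity)]
    have : c ^ 2 * (32 * M * Real.log (1 / δ)) / (2 * (M * (4 * c) ^ 2)) = Real.log (1 / δ) := by
      field_simp
      ring
    rw [this, one_div, Real.log_inv, neg_neg, Real.exp_log hδ0]
  rw [hexp] at hdev
  refine (sub_le_sub_left hdev 1).trans (hS.one_sub_le_measureReal _ fun ω hω => ?_)
  intro θ hθ hmin
  set z : Fin M → Fin N × Fin N × Fin 2 := fun m => (i m ω, j m ω, y m ω) with hz
  simp only [Finset.mem_filter, Finset.mem_univ, true_and, not_exists, not_lt] at hω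
  have hω' := hω ⟨θ, hθ⟩
  have hloss : ∀ θ' : net.params, logisticLoss x (fun m => i m ω) (fun m => j m ω)
      (fun m => y m ω) (net.fn θ') = 1 / (M : ℝ) * ∑ m, netLoss net x θ' (z m) := fun _ => rfl
  have hmin' : ∑ m, netLoss net x ⟨θ, hθ⟩ (z m) ≤ ∑ m, netLoss net x ⟨A₀, hA₀⟩ (z m) := by
    have h := hmin hA₀
    have h1 := hloss ⟨θ, hθ⟩
    have h2 := hloss ⟨A₀, hA₀⟩
    simp only [Set.mem_ofPred_eq] at h
    rw [h1, h2] at h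
    exact le_of_mul_le_mul_left h (by positivity)
  have hrad := empRad_netLoss_le net x hD ⟨A₀, hA₀⟩ hK hα0 hα1 hQ hM z
  have hfinal := deviation_add_approx_le_errorSq hα0 hα1 hν0 hδ0 hδ1 hM
    (famNorm_nonneg (sampleFam x z)) hrad ht
  rw [famNorm_sampleFam] at hfinal
  refine le_trans ?_ hfinal
  have hmean : ∀ θ' : net.params, mean (annotationLaw P) (netLoss net x θ') =
      1 / (N : ℝ) ^ 2 * ∑ a, ∑ b, crossEntropy (P a b) (gram (net.fn θ') x a b) := fun θ' =>
    mean_annotationLaw_crossEntropy _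
  have hlow := frobNorm_sub_sq_le_excess hP fun a b =>
    ⟨hα0.trans (hQ θ hθ a b).1, (hQ θ hθ a b).2.trans (by linarith)⟩
  have hupp := excess_le_of_approx hN hα0 hν0 hν1 hP (hQ A₀ hA₀) hPQ
  have h1 := hmean ⟨θ, hθ⟩
  have h2 := hmean ⟨A₀, hA₀⟩
  simp only at h1 h2
  rw [← h1] at hlow
  rw [← h2] at hupp
  -- Off the exceptional set, the uniform bound combines with `hmin'`, which cancels the empirical
  -- losses of `θ` and `A₀`.
  have h3 : mean (annotationLaw P) (netLoss net x ⟨θ, hθ⟩) -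
      mean (annotationLaw P) (netLoss net x ⟨A₀, hA₀⟩) ≤ (2 * empRad (netLoss net x) z + t) / M := by
    rw [le_div_iff₀ hM']
    linarith
  linarith
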